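/- Let $k$ be an algebraically closed field of characteristic zero, let $n\ge 2$, and let $\mathfrak{ym}(n)=\mathfrak f(n)/\langle \sum_{i=1}^n [x_i,[x_i,x_j]] : 1\le j\le n\rangle$ be the Yang-Mills Lie algebra, where $\mathfrak f(n)$ is the free Lie algebra over $k$ on $x_1,\dots,x_n$. Let $V(n)$ be the vector space with basis $x_1,\dots,x_n$. Its symmetric algebra $S(V(n))$ is a $\mathfrak{ym}(n)$-module: an element of $\mathfrak{ym}(n)$ acts as multiplication by its image in $\mathfrak{ym}(n)/[\mathfrak{ym}(n),\mathfrak{ym}(n)]\simeq V(n)$. Let $H_\bullet(\mathfrak{ym}(n),S(V(n)))=\mathrm{Tor}_\bullet^{\mathcal U(\mathfrak{ym}(n))}(k,S(V(n)))$ be the Lie homology, computed by the bar complex with terms $\mathcal U(\mathfrak{ym}(n))^{\otimes i}\otimes S(V(n))$. Then $$H_0(\mathfrak{ym}(n),S(V(n)))\simeq k,\qquad H_i(\mathfrak{ym}(n),S(V(n)))=0\ \text{ for all } i\ge 2 .$$ For $p\in\mathbb N_0$ let $H_1^p\subseteq H_1(\mathfrak{ym}(n),S(V(n)))$ be the subspace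 of classes of $1$-cycles in $\mathcal U(\mathfrak{ym}(n))\otimes S(V(n))$ that are homogeneous of total degree $p+1$, where every $x_i$ has degree $1$. Then $$H_1(\mathfrak{ym}(n),S(V(n)))=\bigoplus_{p\ge 0}H_1^p .$$ Moreover, sending $\sum_i w_i\otimes x_i$ to the class of $\sum_i x_i\otimes w_i$ induces, for every $p$, an isomorphism from the homology at the middle term of $$S^{p-2}(V(n))\otimes V(n)\xrightarrow{\ d_2\ }S^{p}(V(n))\otimes V(n)\xrightarrow{\ d_1\ }S^{p+1}(V(n)),$$ $$d_1(w\otimes x_i)=x_iw,\qquad d_2(w\otimes x_i)=\sum_{j=1}^n\left(x_j^2w\otimes x_i-x_ix_jw\otimes x_j\right),$$ (with $S^{q}(V(n))=0$ for $q<0$) onto $H_1^p$. Every $H_1^p$ is finite dimensional, and $$\dim_k H_1^p=\begin{cases} n\frac{(n+p-1)!}{(n-1)!}-\frac{(n+p)!}{(n-1)!\,(p+1)!}, & p=0 \text{ or } p=1,\\[2pt] n\frac{(n+1)!}{(n-1)!\,2!}-\frac{(n+2)!}{(n-1)!\,3!}-n, & p=2,\\[2pt] n\frac{(n+p-1)!}{(n-1)!\,p!}-\frac{(n+p)!}{(n-1)!\,(p+1)!}-n\frac{(n+p-3)!}{(n-1)!\,(p-2)!}+\frac{(n+p-4)!}{(n-1)!\,(p-3)!},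 & p\ge 3. \end{cases}$$ -/

import Mathlib

open scoped TensorProduct Nat

universe u

set_option linter.unusedSectionVars false

noncomputable section

namespace YangMills

attribute [local instance 100] LieRing.ofAssociativeRing

section LieHomology

/-! ### Lie algebra homology `H_i(g, M) = Tor_i^{U(g)}(k, M)`

The homology is that of the bar complex of the augmented algebra `A = U(g)` with coefficients in
the `g`-module `M`; its `i`-th term is `A ⊗ ⋯ ⊗ A ⊗ M`, with `i` factors `A`, tensor products
being taken over `k`. -/

variable (k : Type u) [Field k] (g : Type u) [LieRing g] [LieAlgebra k g]
  (M : Type u) [AddCommGroup M] [Module k M] [LieRingModule g M] [LieModule k g M]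

/-- The augmentation of the enveloping algebra, which kills the image of `g`. -/
def augmentation : UniversalEnvelopingAlgebra k g →ₐ[k] k :=
  UniversalEnvelopingAlgebra.lift k (0 : g →ₗ⁅k⁆ k)

/-- The action of the enveloping algebra on a `g`-module. -/
def envAction : UniversalEnvelopingAlgebra k g →ₐ[k] Module.End k M :=
  UniversalEnvelopingAlgebra.lift k (LieModule.toEnd k g M)

/-- The chains `U(g)^{⊗ i} ⊗ M`. -/
def chains : ℕ → ModuleCat.{u} k
  | 0 => ModuleCat.of k M
  | i + 1 => ModuleCat.of k (UniversalEnvelopingAlgebra k g ⊗[k] (chains i : Type u))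

/-- The pure tensor `a ⊗ x`, as a bilinear map `U(g) × U(g)^{⊗ i} ⊗ M ⟶ U(g)^{⊗ (i + 1)} ⊗ M`. -/
def tens (i : ℕ) :
    UniversalEnvelopingAlgebra k g →ₗ[k] chains k g M i →ₗ[k] chains k g M (i + 1) :=
  TensorProduct.mk k (UniversalEnvelopingAlgebra k g) (chains k g M i : Type u)

/-- The linear map `a ⊗ x ↦ f a x`. -/
def liftTens {i : ℕ} {N : Type u} [AddCommGroup N] [Module k N]
    (f : UniversalEnvelopingAlgebra k g →ₗ[k] chains k g M i →ₗ[k] N) :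
    chains k g M (i + 1) →ₗ[k] N :=
  TensorProduct.lift (M := UniversalEnvelopingAlgebra k g) (N := (chains k g M i : Type u)) f

variable {k g M} in
theorem liftTens_tens {i : ℕ} {N : Type u} [AddCommGroup N] [Module k N]
    (f : UniversalEnvelopingAlgebra k g →ₗ[k] chains k g M i →ₗ[k] N)
    (a : UniversalEnvelopingAlgebra k g) (x : chains k g M i) :
    liftTens k g M f (tens k g M i a x) = f a x := rfl

variable {k g M} in
theorem chains_ext {i : ℕ} {N : Type u} [AddCommGroup N] [Module k N]
    {f f' : chains k g M (i + 1) →ₗ[k] N}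
    (h : ∀ a x, f (tens k g M i a x) = f' (tens k g M i a x)) : f = f' :=
  TensorProduct.ext' (M := UniversalEnvelopingAlgebra k g) (N := (chains k g M i : Type u)) h

/-- The action of `U(g)` on `U(g)^{⊗ i} ⊗ M` through the leftmost factor (which is `M` itself if
`i = 0`): `a (b ⊗ x) = a b ⊗ x`. -/
def leftAction : (i : ℕ) → UniversalEnvelopingAlgebra k g →ₗ[k] chains k g M i →ₗ[k] chains k g M i
  | 0 => (envAction k g M).toLinearMap
  | i + 1 => (LinearMap.rTensorHom (chains k g M i : Type u)).comp
      (LinearMap.mul k (UniversalEnvelopingAlgebra k g))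

/-- The differential of the bar resolution
`⋯ ⟶ A ⊗ A ⊗ M ⟶ A ⊗ M ⟶ M ⟶ 0` of `M` by free left modules over `A = U(g)`. It sends
`a₀ ⊗ a₁ ⊗ ⋯ ⊗ aᵢ ⊗ m` to the sum of `(-1)^j a₀ ⊗ ⋯ ⊗ aⱼ aⱼ₊₁ ⊗ ⋯ ⊗ m` over `0 ≤ j < i` and of
`(-1)^i a₀ ⊗ ⋯ ⊗ aᵢ m`. -/
def resolutionD : (i : ℕ) → chains k g M (i + 1) →ₗ[k] chains k g M i
  | 0 => liftTens k g M (leftAction k g M 0)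
  | i + 1 => liftTens k g M (leftAction k g M (i + 1) -
      (tens k g M i).compl₂ (resolutionD i))

/-- The map `a ⊗ x ↦ ε(a) x`. -/
def augmentFirst (i : ℕ) : chains k g M (i + 1) →ₗ[k] chains k g M i :=
  liftTens k g M
    ((LinearMap.lsmul k (chains k g M i : Type u)).comp (augmentation k g).toLinearMap)

/-- The differential of the bar complex, obtained from the bar resolution by applying
`k ⊗_{U(g)} -`. -/
def boundary (i : ℕ) : chains k g M (i + 1) →ₗ[k] chains k g M i :=
  augmentFirst k g M i - resolutionD k g M i

theorem leftAction_tens (i : ℕ) (a b : UniversalEnvelopingAlgebra k g) (x : chains k g M i) :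
    leftAction k g M (i + 1) a (tens k g M i b x) = tens k g M i (a * b) x := rfl

theorem leftAction_mul (i : ℕ) (a b : UniversalEnvelopingAlgebra k g) (x : chains k g M i) :
    leftAction k g M i (a * b) x = leftAction k g M i a (leftAction k g M i b x) := by
  cases i with
  | zero => exact congrArg (fun f : Module.End k M => f x) (map_mul (envAction k g M) a b)
  | succ i =>
    suffices h : leftAction k g M (i + 1) (a * b) =
        (leftAction k g M (i + 1) a).comp (leftAction k g M (i + 1) b) from
      LinearMap.congr_fun h x
    refine chains_ext fun c y => ?_
    rw [LinearMap.comp_apply, leftAction_tens, leftAction_tens, leftAction_tens, mul_assoc]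

theorem resolutionD_zero (a : UniversalEnvelopingAlgebra k g) (x : chains k g M 0) :
    resolutionD k g M 0 (tens k g M 0 a x) = leftAction k g M 0 a x := rfl

theorem resolutionD_succ (i : ℕ) (a : UniversalEnvelopingAlgebra k g) (x : chains k g M (i + 1)) :
    resolutionD k g M (i + 1) (tens k g M (i + 1) a x) =
      leftAction k g M (i + 1) a x - tens k g M i a (resolutionD k g M i x) := rfl

theorem augmentFirst_tens (i : ℕ) (a : UniversalEnvelopingAlgebra k g) (x : chains k g M i) :
    augmentFirst k g M i (tens k g M i a x) = augmentation k g a • x := rfl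

theorem resolutionD_leftAction (i : ℕ) (a : UniversalEnvelopingAlgebra k g)
    (x : chains k g M (i + 1)) :
    resolutionD k g M i (leftAction k g M (i + 1) a x) =
      leftAction k g M i a (resolutionD k g M i x) := by
  suffices h : (resolutionD k g M i).comp (leftAction k g M (i + 1) a) =
      (leftAction k g M i a).comp (resolutionD k g M i) from LinearMap.congr_fun h x
  refine chains_ext fun b y => ?_
  rw [LinearMap.comp_apply, LinearMap.comp_apply, leftAction_tens]
  cases i with
  | zero => rw [resolutionD_zero, resolutionD_zero, leftAction_mul]
  | succ i => rw [resolutionD_succ, resolutionD_succ, leftAction_mul, map_sub, leftAction_tens]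

theorem resolutionD_resolutionD (i : ℕ) (x : chains k g M (i + 2)) :
    resolutionD k g M i (resolutionD k g M (i + 1) x) = 0 := by
  induction i with
  | zero =>
    suffices h : (resolutionD k g M 0).comp (resolutionD k g M 1) = 0 from LinearMap.congr_fun h x
    refine chains_ext fun a y => ?_
    rw [LinearMap.comp_apply, resolutionD_succ, map_sub, resolutionD_leftAction, resolutionD_zero,
      sub_self, LinearMap.zero_apply]
  | succ i ih =>
    suffices h : (resolutionD k g M (i + 1)).comp (resolutionD k g M (i + 2)) = 0 from
      LinearMap.congr_fun h x
    refine chains_ext fun a y => ?_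
    rw [LinearMap.comp_apply, resolutionD_succ, map_sub, resolutionD_leftAction, resolutionD_succ,
      ih, map_zero, sub_zero, sub_self, LinearMap.zero_apply]

/-- The bar complex is a complex. -/
theorem boundary_boundary (i : ℕ) (x : chains k g M (i + 2)) :
    boundary k g M i (boundary k g M (i + 1) x) = 0 := by
  have h1 : ∀ (a : UniversalEnvelopingAlgebra k g) (y : chains k g M (i + 1)),
      augmentFirst k g M i (leftAction k g M (i + 1) a y) =
        augmentation k g a • augmentFirst k g M i y := fun a y => by
    suffices h : (augmentFirst k g M i).comp (leftAction k g M (i + 1) a) =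
        augmentation k g a • augmentFirst k g M i from LinearMap.congr_fun h y
    refine chains_ext fun b z => ?_
    rw [LinearMap.comp_apply, leftAction_tens, augmentFirst_tens, LinearMap.smul_apply,
      augmentFirst_tens, map_mul, mul_smul]
  suffices h : (boundary k g M i).comp (boundary k g M (i + 1)) = 0 from LinearMap.congr_fun h x
  refine chains_ext fun a y => ?_
  rw [LinearMap.comp_apply, LinearMap.zero_apply]
  have h2 := resolutionD_resolutionD k g M i (tens k g M (i + 1) a y)
  have h3 : boundary k g M (i + 1) (tens k g M (i + 1) a y) =
      augmentation k g a • y - resolutionD k g M (i + 1) (tens k g M (i + 1) a y) := rfl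
  have h4 : augmentFirst k g M i (resolutionD k g M (i + 1) (tens k g M (i + 1) a y)) =
      augmentation k g a • augmentFirst k g M i y -
        augmentation k g a • resolutionD k g M i y := by
    rw [resolutionD_succ, map_sub, h1, augmentFirst_tens]
  rw [h3, map_sub, map_smul, boundary, LinearMap.sub_apply, LinearMap.sub_apply, h2, h4, smul_sub]
  abel

/-- The `i`-cycles. -/
def cycles : (i : ℕ) → Submodule k (chains k g M i)
  | 0 => ⊤
  | i + 1 => LinearMap.ker (boundary k g M i)

/-- The Lie algebra homology `H_i(g, M)`. -/
abbrev Homology (i : ℕ) : Type u :=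
  cycles k g M i ⧸ (LinearMap.range (boundary k g M i)).submoduleOf (cycles k g M i)

end LieHomology

section YangMillsAlgebra

variable (k : Type u) [Field k] (n : ℕ)

/-- The relation `∑ i, [xᵢ, [xᵢ, xⱼ]]`. -/
def relation (j : Fin n) : FreeLieAlgebra k (Fin n) :=
  ∑ i : Fin n, ⁅FreeLieAlgebra.of k i, ⁅FreeLieAlgebra.of k i, FreeLieAlgebra.of k j⁆⁆

/-- The ideal of the free Lie algebra generated by the Yang-Mills relations. -/
def relationIdeal : LieIdeal k (FreeLieAlgebra k (Fin n)) :=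
  LieSubmodule.lieSpan k _ (Set.range (relation k n))

/-- The Yang-Mills Lie algebra `ym(n)`. -/
abbrev Ym : Type u := FreeLieAlgebra k (Fin n) ⧸ relationIdeal k n

/-- The generators of `ym(n)`. -/
def gen (i : Fin n) : Ym k n := LieSubmodule.Quotient.mk (FreeLieAlgebra.of k i)

/-- The symmetric algebra `S(V(n))` of the vector space `V(n)` with basis `x₁, …, xₙ`. -/
abbrev Sym : Type u := MvPolynomial (Fin n) k

/-- The map from the free Lie algebra to `V(n) ⊆ S(V(n))` sending brackets to zero and generators
to generators. -/
def freeToSym : FreeLieAlgebra k (Fin n) →ₗ⁅k⁆ Sym k n :=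
  FreeLieAlgebra.lift k fun i => (MvPolynomial.X i : Sym k n)

theorem freeToSym_lie (a b : FreeLieAlgebra k (Fin n)) : freeToSym k n ⁅a, b⁆ = 0 := by
  rw [LieHom.map_lie, LieRing.of_associative_ring_bracket, mul_comm, sub_self]

theorem relationIdeal_le :
    (relationIdeal k n).toSubmodule ≤ LinearMap.ker (freeToSym k n : _ →ₗ[k] Sym k n) := by
  have h : relationIdeal k n ≤ (freeToSym k n).ker := by
    refine LieSubmodule.lieSpan_le.2 ?_
    rintro _ ⟨j, rfl⟩
    change freeToSym k n (∑ i : Fin n, ⁅FreeLieAlgebra.of k i,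
      ⁅FreeLieAlgebra.of k i, FreeLieAlgebra.of k j⁆⁆) = 0
    exact (map_sum (freeToSym k n) _ _).trans
      (Finset.sum_eq_zero fun i _ => freeToSym_lie k n _ _)
  exact fun x hx => (LieHom.mem_ker (f := freeToSym k n) (x := x)).1 (h hx)

/-- The projection `ym(n) ⟶ ym(n) / [ym(n), ym(n)] = V(n) ⊆ S(V(n))`. -/
def toSym : Ym k n →ₗ[k] Sym k n :=
  Submodule.liftQ (relationIdeal k n).toSubmodule (freeToSym k n : _ →ₗ[k] Sym k n)
    (relationIdeal_le k n)

theorem toSym_gen (i : Fin n) : toSym k n (gen k n i) = MvPolynomial.X i :=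
  FreeLieAlgebra.lift_of_apply (R := k) (fun i => (MvPolynomial.X i : Sym k n)) i

theorem toSym_lie (a b : Ym k n) : toSym k n ⁅a, b⁆ = 0 := by
  obtain ⟨a, rfl⟩ := LieSubmodule.Quotient.surjective_mk' _ a
  obtain ⟨b, rfl⟩ := LieSubmodule.Quotient.surjective_mk' _ b
  exact freeToSym_lie k n a b

/-- `ym(n)` acts on `S(V(n))` by multiplication, through the projection to `V(n)`. -/
instance : LieRingModule (Ym k n) (Sym k n) where
  bracket y m := toSym k n y * m
  add_lie x y m := by change toSym k n (x + y) * m = _; rw [map_add, add_mul]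
  lie_add x m m' := mul_add _ _ _
  leibniz_lie x y m := by
    change toSym k n x * (toSym k n y * m) =
      toSym k n ⁅x, y⁆ * m + toSym k n y * (toSym k n x * m)
    rw [toSym_lie]
    ring

theorem lie_def (y : Ym k n) (m : Sym k n) : ⁅y, m⁆ = toSym k n y * m := rfl

instance : LieModule k (Ym k n) (Sym k n) where
  smul_lie t x m := by rw [lie_def, lie_def, map_smul, smul_mul_assoc]
  lie_smul t x m := by rw [lie_def, lie_def, mul_smul_comm]

/-- The Lie homology `H_i(ym(n), S(V(n)))`. -/
abbrev H (i : ℕ) : Type u := Homology k (Ym k n) (Sym k n) i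

/-- The degree `d` component of `U(ym(n))` for the usual grading: it is spanned by the products of
`d` generators. -/
def envDegree (d : ℕ) : Submodule k (UniversalEnvelopingAlgebra k (Ym k n)) :=
  Submodule.span k (Set.range fun i => UniversalEnvelopingAlgebra.ι k (gen k n i)) ^ d

/-- The degree `d` component of the space of `1`-chains `U(ym(n)) ⊗ S(V(n))`, for the total
grading; `S(V(n))` has its usual grading. -/
def chainsDegree (d : ℕ) : Submodule k (chains k (Ym k n) (Sym k n) 1) :=
  Submodule.span k {z | ∃ i j : ℕ, i + j = d ∧ ∃ a ∈ envDegree k n i,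
    ∃ m ∈ MvPolynomial.homogeneousSubmodule (Fin n) k j, z = tens k (Ym k n) (Sym k n) 0 a m}

/-- The graded piece `H_1^p` of `H_1(ym(n), S(V(n)))`: it consists of the classes of the cycles that
are homogeneous of degree `p + 1` for the usual grading. -/
def H1 (p : ℕ) : Submodule k (H k n 1) :=
  ((chainsDegree k n (p + 1)).submoduleOf (cycles k (Ym k n) (Sym k n) 1)).map
    (Submodule.mkQ _)

/-! The part of the Koszul complex around degree `1`. An element `∑ i, wᵢ ⊗ xᵢ` of
`S(V(n)) ⊗ V(n)` is written as the family `w`. -/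

/-- `d₁ (w ⊗ xᵢ) = xᵢ w`. -/
def koszulD1 : (Fin n → Sym k n) →ₗ[k] Sym k n :=
  ∑ i, (LinearMap.mulLeft k (MvPolynomial.X i : Sym k n)).comp (LinearMap.proj i)

/-- `d₂ (w ⊗ xᵢ) = ∑ j, (xⱼ² w ⊗ xᵢ - xᵢ xⱼ w ⊗ xⱼ)`. -/
def koszulD2 : (Fin n → Sym k n) →ₗ[k] (Fin n → Sym k n) :=
  ∑ i, (∑ j : Fin n,
    ((LinearMap.single k (fun _ : Fin n => Sym k n) i).comp
        (LinearMap.mulLeft k ((MvPolynomial.X j : Sym k n) ^ 2)) -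
      (LinearMap.single k (fun _ : Fin n => Sym k n) j).comp
        (LinearMap.mulLeft k (MvPolynomial.X i * MvPolynomial.X j : Sym k n)))).comp
    (LinearMap.proj i)

/-- The subspace `S^p(V(n)) ⊗ V(n)`. -/
def koszulDegree (p : ℕ) : Submodule k (Fin n → Sym k n) :=
  Submodule.pi Set.univ fun _ => MvPolynomial.homogeneousSubmodule (Fin n) k p

/-- The kernel of `d₁ : S^p(V(n)) ⊗ V(n) ⟶ S^{p+1}(V(n))`. -/
def koszulCycles (p : ℕ) : Submodule k (Fin n → Sym k n) :=
  koszulDegree k n p ⊓ LinearMap.ker (koszulD1 k n)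

/-- The image of `d₂ : S^{p-2}(V(n)) ⊗ V(n) ⟶ S^p(V(n)) ⊗ V(n)`; here `S^{p-2}(V(n)) = 0` if
`p < 2`. -/
def koszulBoundaries : ℕ → Submodule k (Fin n → Sym k n)
  | 0 => ⊥
  | 1 => ⊥
  | p + 2 => (koszulDegree k n p).map (koszulD2 k n)

/-- The homology in degree `1` of the `p`-th homogeneous part of the Koszul complex. -/
abbrev KoszulH1 (p : ℕ) : Type u :=
  koszulCycles k n p ⧸ (koszulBoundaries k n p).submoduleOf (koszulCycles k n p)

/-- The `1`-chain `∑ i, xᵢ ⊗ wᵢ` of the bar complex given by an element `∑ i, wᵢ ⊗ xᵢ` of the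
Koszul complex. -/
def koszulChain (w : Fin n → Sym k n) : chains k (Ym k n) (Sym k n) 1 :=
  ∑ i, tens k (Ym k n) (Sym k n) 0 (UniversalEnvelopingAlgebra.ι k (gen k n i)) (w i)

end YangMillsAlgebra

end YangMills

end

/-!
Write `A` for the Yang-Mills algebra `U(ym(n))`, `xᵢ` for its generators, and `M` for `S(V(n))`.
A family of operators `Xᵢ` on a space `N` satisfying the Yang-Mills relations `∑ [Xᵢ, [Xᵢ, Xⱼ]] = 0`
(`cubic X j = 0`) is the same thing as an `A`-module, and it has a Koszul complex
`0 ⟶ N ⟶ Nⁿ ⟶ Nⁿ ⟶ N` with the differentials `kd3`, `kd2`, `kd1`. The theorem follows from the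
exactness of this complex for `N = A` (`koszulExact_leftX`), and this is proved without a normal
form for `A`, that is, without the Poincaré-Birkhoff-Witt theorem or Gröbner bases.

* At the right-hand `Aⁿ` exactness only says that `A` is presented by the Yang-Mills relations. The
  operators `(m, w) ↦ (Xᵢ m, [m eᵢ])` on `N × coker kd2` again satisfy the relations, so `A` acts,
  and the second component of the action is a total Fox derivative `fox` with
  `fox (xᵢ a) m = [(a m) eᵢ]`. It inverts `(wᵢ) ↦ ∑ xᵢ wᵢ` modulo the image of `kd2`.
* Fix an index `t` and put `yⱼ = [x_t, xⱼ]`. The relation with index `t` reads `∑ [xⱼ, yⱼ] = 0`, and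
  every right syzygy `∑ (xⱼ eⱼ + yⱼ fⱼ) = 0`, with `j ≠ t`, is a multiple of it (`syzygy`). Indeed,
  expanding `yⱼ` turns the syzygy into an element of the kernel of `kd1`, hence into the image under
  `kd2` of a family `g`, and the component of this equation at `t` is again a syzygy of the same
  shape, of smaller degree, with `f` replaced by `-g`. So induction on the degree applies
  (`syzygy_aux`).
* When `n ≥ 2`, iterating `syzygy` shows that no nonzero element is annihilated by all `xⱼ` with
  `j ≠ t` (`eq_zero_of_envX_mul`). The component at `t` of the equation `kd2 a = 0` is a syzygy of
  the above kind, and so `a` lies in the image of `kd3`.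

Exactness passes to the free modules `A^{⊗ (j + 1)} ⊗ M`. For `N = M` the complex is still exact at
its first two terms, because the quadratic form `∑ xₗ²` is not divisible by any variable when
`n ≥ 2` (`symX_exact_two`). A diagram chase in the double complex formed by the bar resolution and
the Koszul complexes gives the vanishing of the homology in degrees at least two
(`exists_boundary_eq`).

In degree one no resolution is needed. The Fox derivative with coefficients in `M` kills boundaries
and sends the class of `∑ xᵢ ⊗ wᵢ` to the class of `w`, while every `1`-chain is homologous to one
of this form (`exists_sub_koszulChainₗ_mem`). This yields the isomorphism with the Koszul homology,
which respects degrees (`koszulEquiv`). The dimensions follow by counting monomials in the Koszul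
complex of `M`.
-/

noncomputable section

namespace YangMills

attribute [local instance 100] LieRing.ofAssociativeRing

section UniversalProperty

/-! ### The universal property of the Yang-Mills algebra -/

/-- The associative Yang-Mills expression `∑ i, [Xᵢ, [Xᵢ, Xⱼ]]`, written out with commutators. -/
def cubic {n : ℕ} {R : Type*} [Ring R] (X : Fin n → R) (j : Fin n) : R :=
  ∑ i, (X i * (X i * X j - X j * X i) - (X i * X j - X j * X i) * X i)

variable (k : Type u) [Field k] (n : ℕ)

/-- The Yang-Mills algebra, the enveloping algebra of `ym(n)`. -/
abbrev Env : Type u := UniversalEnvelopingAlgebra k (Ym k n)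

/-- The generators of the Yang-Mills algebra. -/
def envX (i : Fin n) : Env k n := UniversalEnvelopingAlgebra.ι k (gen k n i)

variable {k n} {E : Type u} [Ring E] [Algebra k E]

/-- The Lie algebra map out of `ym(n)` given by elements satisfying the Yang-Mills relations. -/
def ymLift (X : Fin n → E) (h : ∀ j, cubic X j = 0) : Ym k n →ₗ⁅k⁆ E :=
  have hle : (relationIdeal k n).toSubmodule ≤
      LinearMap.ker (FreeLieAlgebra.lift k X : FreeLieAlgebra k (Fin n) →ₗ[k] E) := by
    have h' : relationIdeal k n ≤ (FreeLieAlgebra.lift k X).ker := by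
      refine LieSubmodule.lieSpan_le.2 ?_
      rintro _ ⟨j, rfl⟩
      change FreeLieAlgebra.lift k X (relation k n j) = 0
      rw [relation, map_sum]
      simp only [LieHom.map_lie, FreeLieAlgebra.lift_of_apply, LieRing.of_associative_ring_bracket]
      exact h j
    exact fun x hx => (LieHom.mem_ker (f := FreeLieAlgebra.lift k X) (x := x)).1 (h' hx)
  { Submodule.liftQ (relationIdeal k n).toSubmodule
      (FreeLieAlgebra.lift k X : FreeLieAlgebra k (Fin n) →ₗ[k] E) hle with
    map_lie' := by
      intro a b
      obtain ⟨a, rfl⟩ := LieSubmodule.Quotient.surjective_mk' _ a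
      obtain ⟨b, rfl⟩ := LieSubmodule.Quotient.surjective_mk' _ b
      exact LieHom.map_lie (FreeLieAlgebra.lift k X) a b }

theorem ymLift_gen (X : Fin n → E) (h : ∀ j, cubic X j = 0) (i : Fin n) :
    ymLift (k := k) X h (gen k n i) = X i :=
  FreeLieAlgebra.lift_of_apply (R := k) X i

/-- The algebra map out of the Yang-Mills algebra given by elements satisfying the Yang-Mills
relations. -/
def envLift (X : Fin n → E) (h : ∀ j, cubic X j = 0) : Env k n →ₐ[k] E :=
  UniversalEnvelopingAlgebra.lift k (ymLift X h)

@[simp]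
theorem envLift_envX (X : Fin n → E) (h : ∀ j, cubic X j = 0) (i : Fin n) :
    envLift (k := k) X h (envX k n i) = X i :=
  (UniversalEnvelopingAlgebra.lift_ι_apply k (ymLift X h) (gen k n i)).trans (ymLift_gen X h i)

theorem augmentation_envX (i : Fin n) : augmentation k (Ym k n) (envX k n i) = 0 :=
  UniversalEnvelopingAlgebra.lift_ι_apply k (0 : Ym k n →ₗ⁅k⁆ k) (gen k n i)

theorem env_hom_ext {f g : Env k n →ₐ[k] E} (h : ∀ i, f (envX k n i) = g (envX k n i)) :
    f = g := by
  refine UniversalEnvelopingAlgebra.hom_ext k (LieHom.ext fun x => ?_)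
  obtain ⟨x, rfl⟩ := LieSubmodule.Quotient.surjective_mk' _ x
  let π : FreeLieAlgebra k (Fin n) →ₗ⁅k⁆ Ym k n :=
    { (LieSubmodule.Quotient.mk' (relationIdeal k n) :
        FreeLieAlgebra k (Fin n) →ₗ[k] Ym k n) with
      map_lie' := rfl }
  have : (((f : Env k n →ₗ⁅k⁆ E).comp (UniversalEnvelopingAlgebra.ι k)).comp π) =
      (((g : Env k n →ₗ⁅k⁆ E).comp (UniversalEnvelopingAlgebra.ι k)).comp π) :=
    FreeLieAlgebra.hom_ext fun i => h i
  exact LieHom.congr_fun this x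

variable (k n) in
theorem cubic_envX (j : Fin n) : cubic (envX k n) j = 0 := by
  have h : (LieSubmodule.Quotient.mk (relation k n j) : Ym k n) = 0 :=
    LieSubmodule.Quotient.mk_eq_zero'.2 (LieSubmodule.subset_lieSpan ⟨j, rfl⟩)
  have h2 : (LieSubmodule.Quotient.mk (relation k n j) : Ym k n) =
      ∑ i, ⁅gen k n i, ⁅gen k n i, gen k n j⁆⁆ := by
    rw [relation]
    exact map_sum (LieSubmodule.Quotient.mk' (relationIdeal k n)) _ _
  have h3 := congrArg (UniversalEnvelopingAlgebra.ι k) (h2.symm.trans h)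
  rw [map_zero, map_sum] at h3
  simp only [LieHom.map_lie, LieRing.of_associative_ring_bracket] at h3
  exact h3

/-- Words in the generators span the Yang-Mills algebra. -/
theorem env_induction {p : Env k n → Prop} (one : p 1) (add : ∀ a b, p a → p b → p (a + b))
    (smul : ∀ (c : k) a, p a → p (c • a)) (mul : ∀ i a, p a → p (envX k n i * a))
    (a : Env k n) : p a := by
  let P : Submodule k (Env k n) :=
    { carrier := {a | p a}
      add_mem' := fun {a b} => add a b
      zero_mem' := by simpa using smul 0 1 one
      smul_mem' := fun c a => smul c a }
  let S : Subalgebra k (Env k n) :=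
    { carrier := {a | ∀ b ∈ P, a * b ∈ P}
      add_mem' := fun {a b} ha hb c hc => by rw [add_mul]; exact P.add_mem (ha c hc) (hb c hc)
      mul_mem' := fun {a b} ha hb c hc => by rw [mul_assoc]; exact ha _ (hb c hc)
      algebraMap_mem' := fun r b hb => by
        rw [← Algebra.smul_def]; exact P.smul_mem r hb }
  let X : Fin n → S := fun i => ⟨envX k n i, fun b hb => mul i b hb⟩
  have hX : ∀ j, cubic X j = 0 := fun j => by
    apply Subtype.ext
    have := cubic_envX k n j
    simpa [cubic, X] using this
  have h : S.val.comp (envLift X hX) = AlgHom.id k (Env k n) :=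
    env_hom_ext fun i => by simp [X]
  have ha : a ∈ S := by
    have := DFunLike.congr_fun h a
    rw [AlgHom.comp_apply, AlgHom.id_apply] at this
    rw [← this]
    exact (envLift X hX a).2
  exact (mul_one a ▸ ha 1 one : a ∈ P)

end UniversalProperty

section KoszulMaps

/-! ### The Koszul complex of a family of operators -/

variable {k : Type u} [Field k] {n : ℕ} {N N' : Type*} [AddCommGroup N] [Module k N]
  [AddCommGroup N'] [Module k N']

/-- The map `(wᵢ) ↦ ∑ Xᵢ wᵢ`. -/
def kd1 (X : Fin n → Module.End k N) : (Fin n → N) →ₗ[k] N :=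
  ∑ i, (X i).comp (LinearMap.proj i)

/-- The map given by the matrix `(Cᵢⱼ)` with `∑ i, Xᵢ Cᵢⱼ = ∑ i, [Xᵢ, [Xᵢ, Xⱼ]]`. -/
def kd2 (X : Fin n → Module.End k N) : (Fin n → N) →ₗ[k] (Fin n → N) :=
  LinearMap.pi fun i => ∑ l, ((X i * X l - X l * X i).comp (LinearMap.proj l) +
    ((X l * X l).comp (LinearMap.proj i) - (X l * X i).comp (LinearMap.proj l)))

/-- The map `u ↦ (Xᵢ u)`. -/
def kd3 (X : Fin n → Module.End k N) : N →ₗ[k] (Fin n → N) := LinearMap.pi X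

theorem kd1_apply (X : Fin n → Module.End k N) (w : Fin n → N) : kd1 X w = ∑ i, X i (w i) := by
  simp [kd1]

theorem kd2_apply (X : Fin n → Module.End k N) (w : Fin n → N) (i : Fin n) :
    kd2 X w i = ∑ l, ((X i (X l (w l)) - X l (X i (w l))) +
      (X l (X l (w i)) - X l (X i (w l)))) := by
  simp [kd2]

theorem kd3_apply (X : Fin n → Module.End k N) (u : N) (i : Fin n) : kd3 X u i = X i u := rfl

theorem kd1_kd2_eq (X : Fin n → Module.End k N) (w : Fin n → N) :
    kd1 X (kd2 X w) = ∑ j, cubic X j (w j) := by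
  rw [kd1_apply]
  simp only [kd2_apply, cubic, map_sum, map_sub, map_add, LinearMap.sum_apply,
    LinearMap.sub_apply, Module.End.mul_apply, Finset.sum_add_distrib, Finset.sum_sub_distrib]
  rw [Finset.sum_comm (f := fun i l => X i (X i (X l (w l)))),
    Finset.sum_comm (f := fun i l => X i (X l (X i (w l))))]
  abel

theorem kd1_kd2 {X : Fin n → Module.End k N} (h : ∀ j, cubic X j = 0) (w : Fin n → N) :
    kd1 X (kd2 X w) = 0 := by
  rw [kd1_kd2_eq]
  simp [h]

theorem kd2_kd3 {X : Fin n → Module.End k N} (h : ∀ j, cubic X j = 0) (u : N) :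
    kd2 X (kd3 X u) = 0 := by
  funext i
  have := LinearMap.congr_fun (h i) u
  simp only [cubic, LinearMap.sum_apply, LinearMap.sub_apply, Module.End.mul_apply, map_sub,
    LinearMap.zero_apply] at this
  rw [kd2_apply, Pi.zero_apply, ← this]
  refine Finset.sum_congr rfl fun l _ => ?_
  simp only [kd3_apply]
  abel

variable {X : Fin n → Module.End k N} {X' : Fin n → Module.End k N'} {f : N →ₗ[k] N'}

theorem map_kd1 (h : ∀ i a, f (X i a) = X' i (f a)) (w : Fin n → N) :
    f (kd1 X w) = kd1 X' (fun i => f (w i)) := by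
  simp [kd1_apply, h]

theorem map_kd2 (h : ∀ i a, f (X i a) = X' i (f a)) (w : Fin n → N) (i : Fin n) :
    f (kd2 X w i) = kd2 X' (fun i => f (w i)) i := by
  simp [kd2_apply, h]

end KoszulMaps

section Fox

/-! ### Fox derivatives -/

theorem map_cubic {n : ℕ} {R S : Type*} [Ring R] [Ring S] (f : R →+* S) (X : Fin n → R)
    (j : Fin n) : f (cubic X j) = cubic (fun i => f (X i)) j := by
  simp [cubic]

variable {k : Type u} [Field k] {n : ℕ} {M : Type u} [AddCommGroup M] [Module k M]

/-- The cokernel of the map `kd2`. -/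
abbrev FoxModule (Y : Fin n → Module.End k M) : Type u :=
  (Fin n → M) ⧸ LinearMap.range (kd2 Y)

/-- The operator `(m, w) ↦ (Yᵢ m, [m eᵢ])`. -/
def foxOp (Y : Fin n → Module.End k M) (i : Fin n) : Module.End k (M × FoxModule Y) :=
  ((Y i).prod ((Submodule.mkQ _).comp (LinearMap.single k (fun _ => M) i))).comp
    (LinearMap.fst k M (FoxModule Y))

theorem foxOp_apply (Y : Fin n → Module.End k M) (i : Fin n) (z : M × FoxModule Y) :
    foxOp Y i z = (Y i z.1, Submodule.Quotient.mk (Pi.single i z.1)) := rfl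

theorem kd2_single (Y : Fin n → Module.End k M) (j : Fin n) (m : M) :
    kd2 Y (Pi.single j m) = ∑ i, (Pi.single i (Y i (Y j m) - Y j (Y i m)) -
      (Pi.single i (Y j (Y i m)) - Pi.single j (Y i (Y i m)))) := by
  have hs : ∀ (f : Module.End k M) (l : Fin n),
      f ((Pi.single j m : Fin n → M) l) = (Pi.single j (f m) : Fin n → M) l := fun f l => by
    obtain rfl | h := eq_or_ne l j <;> simp [*]
  funext i
  rw [kd2_apply, Finset.sum_apply]
  simp only [Finset.sum_add_distrib, Finset.sum_sub_distrib, hs, Pi.sub_apply]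
  simp only [Pi.single_apply, Finset.sum_ite_eq, Finset.mem_univ, if_true, Finset.sum_ite_irrel,
    Finset.sum_const_zero]
  have hh : ∀ (f : Fin n → Module.End k M) (v : Fin n → M),
      ∑ x, f x (if x = j then v x else 0) = f j (v j) := fun f v => by
    rw [Finset.sum_eq_single j (fun b _ h => by simp [h]) (by simp)]
    simp
  rw [hh (fun _ => Y i) (fun x => Y x m), hh Y (fun _ => Y i m)]
  split_ifs with h
  · simp only [h]
    abel
  · simp
    abel

theorem cubic_foxOp {Y : Fin n → Module.End k M} (hY : ∀ j, cubic Y j = 0) (j : Fin n) :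
    cubic (foxOp Y) j = 0 := by
  refine LinearMap.ext fun z => ?_
  obtain ⟨m, w⟩ := z
  have h1 := LinearMap.congr_fun (hY j) m
  have h2 : (Submodule.Quotient.mk (kd2 Y (Pi.single j m)) : FoxModule Y) = 0 :=
    (Submodule.Quotient.mk_eq_zero _).2 ⟨_, rfl⟩
  rw [kd2_single] at h2
  simp only [cubic, LinearMap.sum_apply, LinearMap.sub_apply, Module.End.mul_apply, map_sub,
    LinearMap.zero_apply] at h1 ⊢
  refine Prod.ext ?_ ?_
  · rw [Prod.fst_sum, Prod.fst_zero, ← h1]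
    rfl
  · rw [Prod.snd_sum, Prod.snd_zero, ← h2, ← Submodule.mkQ_apply, map_sum]
    refine Finset.sum_congr rfl fun i _ => ?_
    simp [foxOp_apply, Pi.single_sub]

/-- The operators `(m, w) ↦ (Yᵢ m, [m eᵢ])` make `M × FoxModule Y` a module over the Yang-Mills
algebra. -/
def foxHom {Y : Fin n → Module.End k M} (hY : ∀ j, cubic Y j = 0) :
    Env k n →ₐ[k] Module.End k (M × FoxModule Y) :=
  envLift (foxOp Y) (cubic_foxOp hY)

/-- The total Fox derivative: it sends `x_{i₁} ⋯ x_{iᵣ} ⊗ m` to the class of the family with the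
single entry `Y_{i₂} ⋯ Y_{iᵣ} m` at `i₁`. -/
def fox {Y : Fin n → Module.End k M} (hY : ∀ j, cubic Y j = 0) :
    Env k n →ₗ[k] M →ₗ[k] FoxModule Y :=
  LinearMap.mk₂ k (fun a m => (foxHom hY a (m, 0)).2)
    (fun a b m => by simp)
    (fun c a m => by simp)
    (fun a m m' => by
      rw [← Prod.snd_add, ← map_add]; simp)
    (fun c a m => by
      rw [← Prod.smul_snd, ← map_smul]; simp)

variable {Y : Fin n → Module.End k M} (hY : ∀ j, cubic Y j = 0)

theorem foxHom_apply (a : Env k n) (m : M) (w : FoxModule Y) :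
    foxHom hY a (m, w) =
      (envLift Y hY a m, fox hY a m + augmentation k (Ym k n) a • w) := by
  have h2 : foxHom hY a (0, w) = (0, augmentation k (Ym k n) a • w) := by
    induction a using env_induction with
    | one => simp
    | add a b ha hb => simp [ha, hb, add_smul]
    | smul c a ha => simp [ha, smul_smul]
    | mul i a ha =>
      rw [map_mul, Module.End.mul_apply, ha, map_mul, augmentation_envX]
      simp [foxHom, foxOp_apply]
  have h1 : (foxHom hY a (m, 0)).1 = envLift Y hY a m := by
    clear h2
    induction a using env_induction with
    | one => simp
    | add a b ha hb => simp [ha, hb]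
    | smul c a ha => simp [ha]
    | mul i a ha => simp [foxHom, foxOp_apply, ← ha]
  have h3 : ((m, w) : M × FoxModule Y) = (m, 0) + (0, w) := by simp
  rw [h3, map_add, h2]
  exact Prod.ext (by simpa using h1) rfl

theorem fox_mul (a b : Env k n) (m : M) :
    fox hY (a * b) m = fox hY a (envLift Y hY b m) + augmentation k (Ym k n) a • fox hY b m := by
  change (foxHom hY (a * b) (m, 0)).2 = _
  rw [map_mul, Module.End.mul_apply, foxHom_apply, foxHom_apply]
  simp

theorem fox_envX (i : Fin n) (m : M) :
    fox hY (envX k n i) m = Submodule.Quotient.mk (Pi.single i m) := by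
  change (foxHom hY (envX k n i) (m, 0)).2 = _
  rw [foxHom, envLift_envX, foxOp_apply]

end Fox

section Truncation

/-! ### Truncation by degree -/

variable (k : Type u) [Field k] (n : ℕ)

/-- The algebra map recording degrees, which sends `xᵢ` to `xᵢ T`. -/
def degreeHom : Env k n →ₐ[k] Polynomial (Env k n) :=
  envLift (fun i => Polynomial.C (envX k n i) * Polynomial.X) fun j => by
    have h := map_cubic (Polynomial.C : Env k n →+* Polynomial (Env k n)) (envX k n) j
    rw [cubic_envX, map_zero] at h
    have h2 : cubic (fun i => (Polynomial.C (envX k n i) * Polynomial.X : Polynomial (Env k n))) j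
        = cubic (fun i => Polynomial.C (envX k n i)) j * Polynomial.X ^ 3 := by
      have hc : ∀ (a b c : Env k n), (Polynomial.C a * Polynomial.X * (Polynomial.C b *
          Polynomial.X * (Polynomial.C c * Polynomial.X)) : Polynomial (Env k n)) =
            Polynomial.C a * (Polynomial.C b * Polynomial.C c) * Polynomial.X ^ 3 := by
        intro a b c
        rw [mul_assoc (Polynomial.C a), Polynomial.X_mul, mul_assoc (Polynomial.C b),
          Polynomial.X_mul]
        simp only [mul_assoc, pow_succ, pow_zero, one_mul]
      simp only [cubic, mul_sub, sub_mul, Finset.sum_mul, mul_assoc] at hc ⊢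
      simp only [hc]
    rw [h2, ← h, zero_mul]

/-- The part of degree less than `d` of an element of the Yang-Mills algebra. -/
def trunc (d : ℕ) : Env k n →ₗ[k] Env k n :=
  ∑ i ∈ Finset.range d,
    ((Polynomial.lcoeff (Env k n) i).restrictScalars k).comp (degreeHom k n).toLinearMap

variable {k n}

theorem trunc_apply (d : ℕ) (a : Env k n) :
    trunc k n d a = ∑ i ∈ Finset.range d, (degreeHom k n a).coeff i := by
  simp [trunc]

theorem trunc_zero (a : Env k n) : trunc k n 0 a = 0 := by simp [trunc_apply]

theorem trunc_succ_one (d : ℕ) : trunc k n (d + 1) 1 = 1 := by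
  simp [trunc_apply, Polynomial.coeff_one]

theorem trunc_succ_envX_mul (d : ℕ) (i : Fin n) (a : Env k n) :
    trunc k n (d + 1) (envX k n i * a) = envX k n i * trunc k n d a := by
  have h : degreeHom k n (envX k n i * a) =
      Polynomial.C (envX k n i) * (degreeHom k n a * Polynomial.X) := by
    rw [map_mul, degreeHom, envLift_envX, mul_assoc, Polynomial.X_mul]
  rw [trunc_apply, h, Finset.sum_range_succ', trunc_apply, Finset.mul_sum]
  simp

theorem trunc_trunc (d : ℕ) (a : Env k n) : trunc k n d (trunc k n d a) = trunc k n d a := by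
  induction a using env_induction generalizing d with
  | one => cases d <;> simp [trunc_zero, trunc_succ_one]
  | add a b ha hb => simp [ha, hb]
  | smul c a ha => simp [ha]
  | mul i a ha => cases d <;> simp [trunc_zero, trunc_succ_envX_mul, ha]

theorem eventually_trunc_eq (a : Env k n) : ∀ᶠ d in Filter.atTop, trunc k n d a = a := by
  induction a using env_induction with
  | one =>
    filter_upwards [Filter.eventually_ge_atTop 1] with d hd
    obtain ⟨d, rfl⟩ := Nat.exists_eq_add_of_le' hd
    exact trunc_succ_one d
  | add a b ha hb => filter_upwards [ha, hb] with d h h'; simp [h, h']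
  | smul c a ha => filter_upwards [ha] with d h; simp [h]
  | mul i a ha =>
    rw [← Filter.map_add_atTop_eq_nat 1, Filter.eventually_map]
    filter_upwards [ha] with d h
    rw [trunc_succ_envX_mul, h]

theorem trunc_succ_of_eq {d : ℕ} {a : Env k n} (h : trunc k n d a = a) :
    trunc k n (d + 1) a = a := by
  rw [← h]
  generalize a = b
  clear h
  induction b using env_induction generalizing d with
  | one => cases d <;> simp [trunc_zero, trunc_succ_one]
  | add a b ha hb => simp [ha, hb]
  | smul c a ha => simp [ha]
  | mul i a ha => cases d <;> simp [trunc_zero, trunc_succ_envX_mul, ha]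

end Truncation

/-! ### Exactness of the Koszul complex of the Yang-Mills algebra -/

/-- Exactness of `0 ⟶ N ⟶ Nⁿ ⟶ Nⁿ ⟶ N`. -/
structure KoszulExact {k : Type u} [Field k] {n : ℕ} {N : Type*} [AddCommGroup N] [Module k N]
    (X : Fin n → Module.End k N) : Prop where
  exact_one : ∀ w, kd1 X w = 0 → ∃ v, kd2 X v = w
  exact_two : ∀ v, kd2 X v = 0 → ∃ u, kd3 X u = v
  exact_three : ∀ u, kd3 X u = 0 → u = 0

section Exactness

variable (k : Type u) [Field k] (n : ℕ)

/-- Left multiplication by the generators. -/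
def leftX (i : Fin n) : Module.End k (Env k n) := Algebra.lmul k (Env k n) (envX k n i)

theorem cubic_leftX (j : Fin n) : cubic (leftX k n) j = 0 := by
  have h := map_cubic (Algebra.lmul k (Env k n) : Env k n →+* Module.End k (Env k n)) (envX k n) j
  rw [cubic_envX, map_zero] at h
  exact h.symm

variable {k n}

theorem leftX_apply (i : Fin n) (a : Env k n) : leftX k n i a = envX k n i * a := rfl

theorem leftX_exact_one (w : Fin n → Env k n) (hw : ∑ i, envX k n i * w i = 0) :
    ∃ v, kd2 (leftX k n) v = w := by
  have hl : envLift (leftX k n) (cubic_leftX k n) = Algebra.lmul k (Env k n) :=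
    env_hom_ext fun i => by rw [envLift_envX]; rfl
  have h : ∀ i, fox (cubic_leftX k n) (envX k n i * w i) 1 =
      (Submodule.Quotient.mk (Pi.single i (w i)) : FoxModule (leftX k n)) := fun i => by
    rw [fox_mul, hl, augmentation_envX, zero_smul, add_zero, fox_envX]
    simp
  have h2 : (Submodule.Quotient.mk w : FoxModule (leftX k n)) = 0 := by
    rw [← Finset.univ_sum_single w, ← Submodule.mkQ_apply, map_sum]
    simp only [Submodule.mkQ_apply, ← h]
    rw [← LinearMap.sum_apply, ← map_sum, hw, map_zero, LinearMap.zero_apply]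
  exact (Submodule.Quotient.mk_eq_zero _).1 h2

theorem trunc_kd2 (d : ℕ) (v : Fin n → Env k n) (i : Fin n) :
    trunc k n (d + 2) (kd2 (leftX k n) v i) =
      kd2 (leftX k n) (fun l => trunc k n d (v l)) i := by
  simp only [kd2_apply, leftX_apply, map_sum, map_add, map_sub, trunc_succ_envX_mul]

/-- The key step: for a fixed index `t`, the elements `xⱼ` and `yⱼ = [x_t, xⱼ]` with `j ≠ t`
satisfy, as far as right syzygies are concerned, the single relation `∑ [xⱼ, yⱼ] = 0`. By
exactness at the first place a syzygy `(e, f)` produces a family `g` and a syzygy of lower degree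
involving `g`. -/
theorem syzygy_aux (t : Fin n) (d : ℕ) : ∀ (e f : Fin n → Env k n),
    (∀ j, trunc k n (d + 1) (e j) = e j) → (∀ j, trunc k n d (f j) = f j) →
    e t = 0 → f t = 0 →
    ∑ j, (envX k n j * e j +
      (envX k n t * envX k n j - envX k n j * envX k n t) * f j) = 0 →
    ∃ c, ∀ j, j ≠ t → e j = (envX k n t * envX k n j - envX k n j * envX k n t) * c ∧
      f j = -(envX k n j * c) := by
  induction d with
  | zero =>
    intro e f he hf het _ hs
    have hf0 : ∀ j, f j = 0 := fun j => by rw [← hf j, trunc_zero]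
    simp only [hf0, mul_zero, add_zero] at hs
    obtain ⟨g, hg⟩ := leftX_exact_one e hs
    have he0 : ∀ j, e j = 0 := fun j => by
      rw [← he j, ← hg, kd2_apply]
      simp [leftX_apply, trunc_succ_envX_mul, trunc_zero]
    exact ⟨0, fun j _ => by simp [he0, hf0]⟩
  | succ d ih =>
    intro e f he hf het hft hs
    let w : Fin n → Env k n := Function.update (fun j => e j - envX k n t * f j) t
      (∑ j, envX k n j * f j)
    have hwt : w t = ∑ j, envX k n j * f j := Function.update_self ..
    have hwj : ∀ j, j ≠ t → w j = e j - envX k n t * f j := fun j hj =>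
      Function.update_of_ne hj ..
    have hw : ∑ i, envX k n i * w i = 0 := by
      have h1 : ∑ i, envX k n i * w i = envX k n t * w t +
          ∑ i, envX k n i * (e i - envX k n t * f i) := by
        rw [← Finset.add_sum_erase _ _ (Finset.mem_univ t),
          ← Finset.add_sum_erase (a := t) (f := fun i => envX k n i * (e i - envX k n t * f i)) _
            (Finset.mem_univ t), het, hft]
        simp only [mul_zero, sub_zero, zero_add]
        congr 1
        exact Finset.sum_congr rfl fun i hi => by rw [hwj i (Finset.ne_of_mem_erase hi)]
      rw [h1, hwt, ← hs, Finset.mul_sum, ← Finset.sum_add_distrib]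
      refine Finset.sum_congr rfl fun i _ => ?_
      noncomm_ring
    have hwd : ∀ i, trunc k n (d + 2) (w i) = w i := fun i => by
      obtain rfl | hi := eq_or_ne i t
      · rw [hwt, map_sum]
        exact Finset.sum_congr rfl fun j _ => by rw [trunc_succ_envX_mul, hf]
      · rw [hwj i hi, map_sub, he, trunc_succ_envX_mul, hf]
    obtain ⟨g', hg'⟩ := leftX_exact_one w hw
    -- The relation among the `wⱼ` may be taken of the expected degree.
    obtain ⟨g, hg, hgd⟩ : ∃ g, kd2 (leftX k n) g = w ∧ ∀ j, trunc k n d (g j) = g j :=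
      ⟨fun l => trunc k n d (g' l), funext fun i => by rw [← trunc_kd2, hg', hwd],
        fun j => trunc_trunc d _⟩
    have ht := congrFun hg t
    rw [hwt, kd2_apply] at ht
    simp only [leftX_apply] at ht
    obtain ⟨c, hc⟩ := ih
      (Function.update (fun j => f j - envX k n j * g t + envX k n t * g j) t 0)
      (Function.update (fun j => - g j) t 0)
      (fun j => by
        obtain rfl | hj := eq_or_ne j t
        · simp
        · rw [Function.update_of_ne hj, map_add, map_sub, hf, trunc_succ_envX_mul, hgd,
            trunc_succ_envX_mul, hgd])
      (fun j => by
        obtain rfl | hj := eq_or_ne j t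
        · simp
        · rw [Function.update_of_ne hj, map_neg, hgd])
      (by simp) (by simp)
      (by
        rw [← sub_eq_zero, ← Finset.sum_sub_distrib] at ht
        rw [← neg_eq_zero, ← Finset.sum_neg_distrib]
        refine (Finset.sum_congr rfl fun j _ => ?_).trans ht
        obtain rfl | hj := eq_or_ne j t
        · simp [hft]
        · rw [Function.update_of_ne hj, Function.update_of_ne hj]
          noncomm_ring)
    have hgj : ∀ j, j ≠ t → g j = envX k n j * c := fun j hj => by
      have := (hc j hj).2
      rw [Function.update_of_ne hj] at this
      exact neg_injective this
    have hfj : ∀ j, j ≠ t → f j = -(envX k n j * (envX k n t * c - g t)) := fun j hj => by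
      have := (hc j hj).1
      rw [Function.update_of_ne hj, hgj j hj] at this
      rw [show f j = f j - envX k n j * g t + envX k n t * (envX k n j * c) -
        envX k n t * (envX k n j * c) + envX k n j * g t by abel, this]
      noncomm_ring
    refine ⟨envX k n t * c - g t, fun j hj => ⟨?_, hfj j hj⟩⟩
    -- Modulo the image of `kd3`, the family `g` is concentrated at `t`.
    have hg2 : kd2 (leftX k n) (Pi.single t (g t - envX k n t * c)) = w := by
      rw [← hg, ← sub_eq_zero, ← map_sub, ← neg_eq_zero, ← map_neg,
        ← kd2_kd3 (cubic_leftX k n) c]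
      congr 1
      funext i
      obtain rfl | hi := eq_or_ne i t
      · simp [kd3_apply, leftX_apply]
      · simp [kd3_apply, leftX_apply, hi, hgj]
    have hj2 := congrFun hg2 j
    rw [hwj j hj, kd2_apply, Finset.sum_eq_single t
      (fun l _ hl => by simp [hl, hj, leftX_apply]) (by simp), Pi.single_eq_same,
      Pi.single_eq_of_ne hj, hfj j hj] at hj2
    simp only [leftX_apply] at hj2
    rw [eq_add_of_sub_eq hj2.symm]
    noncomm_ring

theorem syzygy (t : Fin n) (e f : Fin n → Env k n) (het : e t = 0) (hft : f t = 0)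
    (hs : ∑ j, (envX k n j * e j +
      (envX k n t * envX k n j - envX k n j * envX k n t) * f j) = 0) :
    ∃ c, ∀ j, j ≠ t → e j = (envX k n t * envX k n j - envX k n j * envX k n t) * c ∧
      f j = -(envX k n j * c) := by
  obtain ⟨d, hd⟩ := ((Filter.eventually_all.2 fun j => eventually_trunc_eq (e j)).and
    (Filter.eventually_all.2 fun j => eventually_trunc_eq (f j))).exists
  exact syzygy_aux t d e f (fun j => trunc_succ_of_eq (hd.1 j)) hd.2 het hft hs

/-- An element annihilated by `xⱼ` for all `j ≠ t` is divisible on the left by `[x_t, xₛ]`, where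
`s ≠ t`, and the quotient is annihilated as well, so that degrees force it to vanish. -/
theorem eq_zero_of_envX_mul {t s : Fin n} (hst : s ≠ t) (b : Env k n)
    (hb : ∀ j, j ≠ t → envX k n j * b = 0) : b = 0 := by
  obtain ⟨d, hd⟩ := (eventually_trunc_eq b).exists
  rw [← hd]
  clear hd
  revert b
  have key : ∀ b : Env k n, (∀ j, j ≠ t → envX k n j * b = 0) → ∃ c : Env k n,
      b = (envX k n t * envX k n s - envX k n s * envX k n t) * c ∧
        ∀ j, j ≠ t → envX k n j * c = 0 := fun b hb => by
    obtain ⟨c, hc⟩ := syzygy t (Pi.single s b) 0 (Pi.single_eq_of_ne hst.symm _) rfl (by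
      rw [Finset.sum_eq_single s (fun l _ hl => by simp [hl]) (by simp)]
      simp [hb s hst])
    refine ⟨c, by simpa using (hc s hst).1, fun j hj => ?_⟩
    simpa using (hc j hj).2.symm
  induction d using Nat.twoStepInduction with
  | zero => exact fun b _ => trunc_zero b
  | one =>
    intro b hb
    obtain ⟨c, rfl, -⟩ := key b hb
    simp [sub_mul, mul_assoc, trunc_succ_envX_mul, trunc_zero]
  | more d ih _ =>
    intro b hb
    obtain ⟨c, rfl, hc⟩ := key b hb
    simp [sub_mul, mul_assoc, trunc_succ_envX_mul, ih c hc]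

variable (k) in
theorem koszulExact_leftX (hn : 2 ≤ n) : KoszulExact (leftX k n) := by
  let t : Fin n := ⟨0, by omega⟩
  let s : Fin n := ⟨1, by omega⟩
  have hst : s ≠ t := by simp [s, t]
  refine ⟨fun w hw => leftX_exact_one w ?_, fun a ha => ?_, fun u hu => ?_⟩
  · rw [← hw, kd1_apply]
    rfl
  · have ht := congrFun ha t
    rw [kd2_apply] at ht
    simp only [leftX_apply, Pi.zero_apply] at ht
    obtain ⟨c, hc⟩ := syzygy t
      (Function.update (fun j => envX k n j * a t - envX k n t * a j) t 0)
      (Function.update a t 0) (by simp) (by simp) (by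
        refine (Finset.sum_congr rfl fun j _ => ?_).trans ht
        obtain rfl | hj := eq_or_ne j t
        · simp
        · rw [Function.update_of_ne hj, Function.update_of_ne hj]
          noncomm_ring)
    have haj : ∀ j, j ≠ t → a j = -(envX k n j * c) := fun j hj => by
      simpa [hj] using (hc j hj).2
    have hat : a t + envX k n t * c = 0 := eq_zero_of_envX_mul hst _ fun j hj => by
      have := (hc j hj).1
      rw [Function.update_of_ne hj, haj j hj] at this
      rw [show envX k n j * (a t + envX k n t * c) = envX k n j * a t -
        envX k n t * -(envX k n j * c) - (envX k n t * envX k n j - envX k n j * envX k n t) * c by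
        noncomm_ring, this, sub_self]
    refine ⟨-c, funext fun j => ?_⟩
    rw [kd3_apply, leftX_apply, mul_neg]
    obtain rfl | hj := eq_or_ne j t
    · exact (eq_neg_of_add_eq_zero_left hat).symm
    · exact (haj j hj).symm
  · exact eq_zero_of_envX_mul hst u fun j _ => congrFun hu j

end Exactness

section Transfer

/-! ### Exactness for free modules and for the symmetric algebra -/

variable {k : Type u} [Field k] {n : ℕ}

/-- Choice with finite support. -/
theorem exists_finsupp_of_forall {ι P Q : Type*} [Zero P] [Zero Q] (R : Q → P → Prop)
    (h0 : R 0 0) (w : ι → Q) (hw : (Function.support w).Finite) (h : ∀ c, ∃ v, R (w c) v) :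
    ∃ v : ι → P, (Function.support v).Finite ∧ ∀ c, R (w c) (v c) := by
  classical
  choose g hg using h
  refine ⟨fun c => if w c = 0 then 0 else g c, hw.subset fun c hc hwc => hc ?_, fun c => ?_⟩
  · exact if_pos hwc
  · dsimp only
    split_ifs with hc
    · rw [hc]; exact h0
    · exact hg c

/-- A direct sum of copies of an exact Koszul complex is exact. -/
theorem KoszulExact.of_finsupp {ι : Type*} {N N' : Type*} [AddCommGroup N] [Module k N]
    [AddCommGroup N'] [Module k N'] {X : Fin n → Module.End k N} {X' : Fin n → Module.End k N'}
    (hX : KoszulExact X) (e : N' ≃ₗ[k] (ι →₀ N)) (he : ∀ i z c, e (X' i z) c = X i (e z c)) :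
    KoszulExact X' := by
  have hfin : ∀ w : Fin n → N', (Function.support fun (c : ι) (i : Fin n) => e (w i) c).Finite :=
    fun w => (Set.finite_iUnion fun i => (e (w i)).hasFiniteSupport).subset fun c hc => by
      by_contra hcc
      refine hc (funext fun i => ?_)
      by_contra hi
      exact hcc (Set.mem_iUnion.2 ⟨i, hi⟩)
  have he' : ∀ (c : ι) i z, ((Finsupp.lapply c : (ι →₀ N) →ₗ[k] N).comp e.toLinearMap) (X' i z) =
      X i (((Finsupp.lapply c : (ι →₀ N) →ₗ[k] N).comp e.toLinearMap) z) := fun c i z => he i z c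
  refine ⟨fun w hw => ?_, fun v hv => ?_, fun u hu => ?_⟩
  · obtain ⟨v, hv, hR⟩ := exists_finsupp_of_forall (fun (a b : Fin n → N) => kd2 X b = a)
      (map_zero _) _ (hfin w) (fun c => hX.exact_one _ (by
        have := map_kd1 (he' c) w
        rw [hw, map_zero] at this
        exact this.symm))
    refine ⟨fun i => e.symm (Finsupp.ofSupportFinite (fun c => v c i)
      (hv.subset fun c hc h0 => hc (congrFun h0 i))), funext fun i => e.injective ?_⟩
    ext c
    have := map_kd2 (he' c) (fun i => e.symm (Finsupp.ofSupportFinite (fun c => v c i)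
      (hv.subset fun c hc h0 => hc (congrFun h0 i)))) i
    refine this.trans ?_
    simp only [LinearMap.comp_apply, LinearEquiv.coe_coe, LinearEquiv.apply_symm_apply]
    exact congrFun (hR c) i
  · obtain ⟨u, hu, hR⟩ := exists_finsupp_of_forall (fun (a : Fin n → N) (b : N) => kd3 X b = a)
      (map_zero _) _ (hfin v) (fun c => hX.exact_two _ (funext fun i => by
        have := map_kd2 (he' c) v i
        rw [hv, Pi.zero_apply, map_zero] at this
        exact this.symm))
    refine ⟨e.symm (Finsupp.ofSupportFinite u hu), funext fun i => e.injective ?_⟩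
    ext c
    rw [kd3_apply, he, LinearEquiv.apply_symm_apply]
    exact congrFun (hR c) i
  · refine e.injective ?_
    ext c
    rw [map_zero, Finsupp.zero_apply]
    refine hX.exact_three _ (funext fun i => ?_)
    rw [kd3_apply, ← he, show X' i u = 0 from congrFun hu i, map_zero]
    rfl

end Transfer

section Chains

variable (k : Type u) [Field k] (n : ℕ)

/-- The spaces `U(ym(n))^{⊗ j} ⊗ S(V(n))` of the bar complex. -/
abbrev SymChains (j : ℕ) : ModuleCat.{u} k := chains k (Ym k n) (Sym k n) j

/-- The action of the generators on the leftmost factor of `U(ym(n))^{⊗ j} ⊗ S(V(n))`. -/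
def chainX (j : ℕ) (i : Fin n) : Module.End k (SymChains k n j) :=
  leftAction k (Ym k n) (Sym k n) j (envX k n i)

variable {k n}

theorem leftAction_one (j : ℕ) (z : SymChains k n j) :
    leftAction k (Ym k n) (Sym k n) j 1 z = z := by
  cases j with
  | zero => exact congrArg (fun f : Module.End k (Sym k n) => f z) (map_one (envAction k _ _))
  | succ j =>
    suffices h : leftAction k (Ym k n) (Sym k n) (j + 1) 1 = LinearMap.id from
      LinearMap.congr_fun h z
    refine chains_ext fun a x => ?_
    rw [leftAction_tens, one_mul, LinearMap.id_apply]

theorem cubic_chainX (j : ℕ) (i : Fin n) : cubic (chainX k n j) i = 0 := by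
  let f : Env k n →ₐ[k] Module.End k (SymChains k n j) :=
    AlgHom.ofLinearMap (leftAction k (Ym k n) (Sym k n) j)
      (LinearMap.ext fun z => leftAction_one j z)
      (fun a b => LinearMap.ext fun z => leftAction_mul k (Ym k n) (Sym k n) j a b z)
  have h := map_cubic (f : Env k n →+* Module.End k (SymChains k n j)) (envX k n) i
  rw [cubic_envX, map_zero] at h
  exact h.symm

theorem koszulExact_chainX (hn : 2 ≤ n) (j : ℕ) : KoszulExact (chainX k n (j + 1)) := by
  classical
  let b := Module.Basis.ofVectorSpace k (SymChains k n j)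
  let e : SymChains k n (j + 1) ≃ₗ[k] (_ →₀ Env k n) :=
    TensorProduct.equivFinsuppOfBasisRight (M := Env k n) b
  refine KoszulExact.of_finsupp (koszulExact_leftX k hn) e fun i z c => ?_
  suffices h : ((Finsupp.lapply c : _ →ₗ[k] Env k n).comp e.toLinearMap).comp (chainX k n (j + 1) i)
      = (leftX k n i).comp ((Finsupp.lapply c : _ →ₗ[k] Env k n).comp e.toLinearMap) from
    LinearMap.congr_fun h z
  refine chains_ext fun a x => ?_
  have h : ∀ a : Env k n, e (tens k (Ym k n) (Sym k n) j a x) c = b.repr x c • a := fun a =>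
    TensorProduct.equivFinsuppOfBasisRight_apply_tmul_apply b a x c
  change e (tens k (Ym k n) (Sym k n) j (envX k n i * a) x) c =
    envX k n i * e (tens k (Ym k n) (Sym k n) j a x) c
  rw [h, h, mul_smul_comm]

/-- The generators act on `S(V(n))` by multiplication by the variables. -/
theorem chainX_zero (i : Fin n) (m : Sym k n) :
    (chainX k n 0 i : Module.End k (Sym k n)) m = MvPolynomial.X i * m := by
  have h : envAction k (Ym k n) (Sym k n) (envX k n i) =
      LieModule.toEnd k (Ym k n) (Sym k n) (gen k n i) :=
    UniversalEnvelopingAlgebra.lift_ι_apply k _ _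
  change envAction k (Ym k n) (Sym k n) (envX k n i) m = _
  rw [h, LieModule.toEnd_apply_apply, lie_def, toSym_gen]
  rfl

/-- Multiplication by the variables on `S(V(n))`. -/
def symX (k : Type u) [Field k] (n : ℕ) (i : Fin n) : Module.End k (Sym k n) :=
  LinearMap.mulLeft k (MvPolynomial.X i)

theorem symX_apply (i : Fin n) (m : Sym k n) : symX k n i m = MvPolynomial.X i * m := rfl

theorem chainX_zero_eq : chainX k n 0 = symX k n :=
  funext fun i => LinearMap.ext fun m => chainX_zero i m

theorem cubic_symX (j : Fin n) : cubic (symX k n) j = 0 := by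
  rw [← chainX_zero_eq]
  exact cubic_chainX 0 j

theorem kd2_symX (w : Fin n → Sym k n) (i : Fin n) :
    kd2 (symX k n) w i = (∑ l, MvPolynomial.X l ^ 2) * w i -
      MvPolynomial.X i * ∑ l, MvPolynomial.X l * w l := by
  rw [kd2_apply, Finset.sum_mul, Finset.mul_sum, ← Finset.sum_sub_distrib]
  refine Finset.sum_congr rfl fun l _ => ?_
  simp only [symX_apply]
  ring

/-- The quadratic form `∑ xₗ²` is prime to each variable, since it takes the value `1` at a basis
vector on which `xᵢ` vanishes. -/
theorem not_X_dvd_sum_sq (hn : 2 ≤ n) (i : Fin n) :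
    ¬ (MvPolynomial.X i : Sym k n) ∣ ∑ l, MvPolynomial.X l ^ 2 := by
  rintro ⟨q, hq⟩
  have : Nontrivial (Fin n) := Fin.nontrivial_iff_two_le.2 hn
  obtain ⟨j, hj⟩ := exists_ne i
  have h := congrArg (MvPolynomial.eval (Pi.single j 1 : Fin n → k)) hq
  rw [map_mul, MvPolynomial.eval_X, Pi.single_eq_of_ne hj.symm, zero_mul, map_sum,
    Finset.sum_eq_single j (fun l _ hl => by simp [hl]) (by simp)] at h
  simp at h

theorem symX_exact_two (hn : 2 ≤ n) (v : Fin n → Sym k n) (hv : kd2 (symX k n) v = 0) :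
    ∃ u, kd3 (symX k n) u = v := by
  have h : ∀ i, (∑ l, MvPolynomial.X l ^ 2) * v i =
      MvPolynomial.X i * ∑ l, MvPolynomial.X l * v l := fun i => by
    rw [← sub_eq_zero, ← kd2_symX, hv, Pi.zero_apply]
  have hdvd : ∀ i, ∃ u, v i = MvPolynomial.X i * u := fun i =>
    ((MvPolynomial.X_prime (i := i)).dvd_or_dvd ⟨_, h i⟩).resolve_left (not_X_dvd_sum_sq hn i)
  choose u hu using hdvd
  have hq : (∑ l : Fin n, (MvPolynomial.X l : Sym k n) ^ 2) ≠ 0 := fun h0 =>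
    not_X_dvd_sum_sq (k := k) hn ⟨0, by omega⟩ (h0 ▸ dvd_zero _)
  have hs : ∀ i, (∑ l, MvPolynomial.X l ^ 2) * u i = ∑ l, MvPolynomial.X l * v l := fun i =>
    mul_left_cancel₀ (MvPolynomial.X_ne_zero i) (by rw [← h i, hu i]; ring)
  let t : Fin n := ⟨0, by omega⟩
  refine ⟨u t, funext fun i => ?_⟩
  rw [kd3_apply, symX_apply, hu i, mul_left_cancel₀ hq ((hs t).trans (hs i).symm)]

theorem symX_exact_three (hn : 2 ≤ n) (u : Sym k n) (hu : kd3 (symX k n) u = 0) : u = 0 := by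
  have h : (MvPolynomial.X (⟨0, by omega⟩ : Fin n) : Sym k n) * u = 0 := congrFun hu _
  exact (mul_eq_zero.1 h).resolve_left (MvPolynomial.X_ne_zero _)

theorem chainX_exact_two (hn : 2 ≤ n) (j : ℕ) (v : Fin n → SymChains k n j)
    (hv : kd2 (chainX k n j) v = 0) : ∃ u, kd3 (chainX k n j) u = v := by
  cases j with
  | zero => rw [chainX_zero_eq] at hv ⊢; exact symX_exact_two hn v hv
  | succ j => exact (koszulExact_chainX hn j).exact_two v hv

theorem chainX_exact_three (hn : 2 ≤ n) (j : ℕ) (u : SymChains k n j)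
    (hu : kd3 (chainX k n j) u = 0) : u = 0 := by
  cases j with
  | zero => rw [chainX_zero_eq] at hu; exact symX_exact_three hn u hu
  | succ j => exact (koszulExact_chainX hn j).exact_three u hu

end Chains

section Vanishing

/-! ### Vanishing of the homology in degrees at least two -/

variable {k : Type u} [Field k] {n : ℕ}

theorem resolutionD_chainX (j : ℕ) (i : Fin n) (z : SymChains k n (j + 1)) :
    resolutionD k (Ym k n) (Sym k n) j (chainX k n (j + 1) i z) =
      chainX k n j i (resolutionD k (Ym k n) (Sym k n) j z) :=
  resolutionD_leftAction k (Ym k n) (Sym k n) j (envX k n i) z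

/-- The bar resolution is exact, with contracting homotopy `z ↦ 1 ⊗ z`. -/
theorem resolutionD_tens_one {j : ℕ} (z : SymChains k n (j + 1))
    (hz : resolutionD k (Ym k n) (Sym k n) j z = 0) :
    resolutionD k (Ym k n) (Sym k n) (j + 1) (tens k (Ym k n) (Sym k n) (j + 1) 1 z) = z := by
  rw [resolutionD_succ, hz, map_zero, sub_zero, leftAction_one]

theorem augmentFirst_tens_one (j : ℕ) (z : SymChains k n j) :
    augmentFirst k (Ym k n) (Sym k n) j (tens k (Ym k n) (Sym k n) j 1 z) = z := by
  rw [augmentFirst_tens, map_one, one_smul]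

theorem augmentFirst_leftAction (j : ℕ) (a : Env k n) (z : SymChains k n (j + 1)) :
    augmentFirst k (Ym k n) (Sym k n) j (leftAction k (Ym k n) (Sym k n) (j + 1) a z) =
      augmentation k (Ym k n) a • augmentFirst k (Ym k n) (Sym k n) j z := by
  suffices h : (augmentFirst k (Ym k n) (Sym k n) j).comp
      (leftAction k (Ym k n) (Sym k n) (j + 1) a) =
      augmentation k (Ym k n) a • augmentFirst k (Ym k n) (Sym k n) j from LinearMap.congr_fun h z
  refine chains_ext fun b x => ?_
  rw [LinearMap.comp_apply, leftAction_tens, augmentFirst_tens, LinearMap.smul_apply,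
    augmentFirst_tens, map_mul, mul_smul]

theorem augmentFirst_kd1 (j : ℕ) (w : Fin n → SymChains k n (j + 1)) :
    augmentFirst k (Ym k n) (Sym k n) j (kd1 (chainX k n (j + 1)) w) = 0 := by
  rw [kd1_apply, map_sum]
  refine Finset.sum_eq_zero fun i _ => ?_
  rw [chainX, augmentFirst_leftAction, augmentation_envX, zero_smul]

theorem augmentFirst_resolutionD (j : ℕ) (z : SymChains k n (j + 2)) :
    augmentFirst k (Ym k n) (Sym k n) j (resolutionD k (Ym k n) (Sym k n) (j + 1) z) =
      boundary k (Ym k n) (Sym k n) j (augmentFirst k (Ym k n) (Sym k n) (j + 1) z) := by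
  suffices h : (augmentFirst k (Ym k n) (Sym k n) j).comp
      (resolutionD k (Ym k n) (Sym k n) (j + 1)) = (boundary k (Ym k n) (Sym k n) j).comp
        (augmentFirst k (Ym k n) (Sym k n) (j + 1)) from LinearMap.congr_fun h z
  refine chains_ext fun a x => ?_
  rw [LinearMap.comp_apply, LinearMap.comp_apply, resolutionD_succ, map_sub,
    augmentFirst_leftAction, augmentFirst_tens, augmentFirst_tens, map_smul, boundary,
    LinearMap.sub_apply, smul_sub]

/-- The kernel of the augmentation is generated by the `xᵢ`. -/
theorem exists_kd1_of_augmentFirst (j : ℕ) (z : SymChains k n (j + 1)) :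
    ∃ w, z = tens k (Ym k n) (Sym k n) j 1 (augmentFirst k (Ym k n) (Sym k n) j z) +
      kd1 (chainX k n (j + 1)) w := by
  suffices h : ∀ (a : Env k n) (x : SymChains k n j), ∃ w, tens k (Ym k n) (Sym k n) j a x =
      tens k (Ym k n) (Sym k n) j 1 (augmentation k (Ym k n) a • x) +
        kd1 (chainX k n (j + 1)) w by
    let f : SymChains k n (j + 1) →ₗ[k] SymChains k n (j + 1) := LinearMap.id -
      (tens k (Ym k n) (Sym k n) j 1).comp (augmentFirst k (Ym k n) (Sym k n) j)
    have h2 : (Submodule.mkQ (LinearMap.range (kd1 (chainX k n (j + 1))))).comp f = 0 := by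
      refine chains_ext fun a x => ?_
      obtain ⟨w, hw⟩ := h a x
      have hf : f (tens k (Ym k n) (Sym k n) j a x) = kd1 (chainX k n (j + 1)) w :=
        sub_eq_of_eq_add' hw
      rw [LinearMap.comp_apply, hf]
      exact (Submodule.Quotient.mk_eq_zero _).2 ⟨w, rfl⟩
    obtain ⟨w, hw⟩ := (Submodule.Quotient.mk_eq_zero _).1 (LinearMap.congr_fun h2 z)
    exact ⟨w, eq_add_of_sub_eq' hw.symm⟩
  intro a x
  induction a using env_induction with
  | one => exact ⟨0, by rw [map_one (augmentation k (Ym k n)), one_smul, map_zero, add_zero]⟩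
  | add a b ha hb =>
    obtain ⟨v, hv⟩ := ha
    obtain ⟨w, hw⟩ := hb
    refine ⟨v + w, ?_⟩
    rw [map_add, LinearMap.add_apply, hv, hw, map_add, add_smul, map_add, map_add]
    abel
  | smul c a ha =>
    obtain ⟨v, hv⟩ := ha
    refine ⟨c • v, ?_⟩
    rw [map_smul, LinearMap.smul_apply, hv, map_smul, smul_add, map_smul,
      map_smul (augmentation k (Ym k n)), map_smul, smul_assoc]
  | mul i a _ =>
    refine ⟨Pi.single i (tens k (Ym k n) (Sym k n) j a x), ?_⟩
    rw [map_mul (augmentation k (Ym k n)), augmentation_envX, zero_mul, zero_smul, map_zero, zero_add,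
      kd1_apply,
      Finset.sum_eq_single i (fun l _ hl => by rw [Pi.single_eq_of_ne hl, map_zero]) (by simp),
      Pi.single_eq_same]
    exact (leftAction_tens k (Ym k n) (Sym k n) j (envX k n i) a x).symm

/-- The diagram chase through the double complex whose rows are the bar resolution and whose columns
are the Koszul complexes of the modules `U(ym(n))^{⊗ j} ⊗ S(V(n))`. -/
theorem exists_boundary_eq (hn : 2 ≤ n) (j : ℕ) (z : SymChains k n (j + 2))
    (hz : boundary k (Ym k n) (Sym k n) (j + 1) z = 0) :
    ∃ u, boundary k (Ym k n) (Sym k n) (j + 2) u = z := by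
  let D := fun i => resolutionD k (Ym k n) (Sym k n) i
  let s := fun i => tens k (Ym k n) (Sym k n) i 1
  have hD : ∀ i (l : Fin n) (x : SymChains k n (i + 1)),
      D i (chainX k n (i + 1) l x) = chainX k n i l (D i x) := resolutionD_chainX
  have hDD : ∀ i (x : SymChains k n (i + 2)), D i (D (i + 1) x) = 0 :=
    resolutionD_resolutionD k (Ym k n) (Sym k n)
  -- Descend from the bar degree of `z` to the end of the Koszul complex.
  obtain ⟨w1, hw1⟩ := exists_kd1_of_augmentFirst (j + 1) (D (j + 2) (s (j + 2) z))
  rw [augmentFirst_resolutionD, augmentFirst_tens_one, hz, map_zero, zero_add] at hw1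
  obtain ⟨w2, hw2⟩ := (koszulExact_chainX hn j).exact_one (fun i => D (j + 1) (w1 i)) (by
    rw [← map_kd1 (hD (j + 1)), ← hw1, hDD])
  obtain ⟨m, hm⟩ := chainX_exact_two hn j (fun i => D j (w2 i)) (by
    funext i
    rw [← map_kd2 (hD j), hw2, hDD, Pi.zero_apply])
  obtain ⟨w3, hw3⟩ : ∃ w3, D j w3 = m := by
    cases j with
    | zero => exact ⟨s 0 m, (resolutionD_zero k (Ym k n) (Sym k n) 1 m).trans (leftAction_one 0 m)⟩
    | succ j =>
      refine ⟨s (j + 1) m, resolutionD_tens_one m ?_⟩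
      refine chainX_exact_three hn j _ (funext fun i => ?_)
      rw [kd3_apply, ← resolutionD_chainX, ← kd3_apply, hm]
      exact hDD j (w2 i)
  -- Climb back, correcting each stage by a boundary of the bar resolution.
  have h2 : ∀ i, D (j + 1) (s (j + 1) (w2 i - kd3 (chainX k n (j + 1)) w3 i)) =
      w2 i - kd3 (chainX k n (j + 1)) w3 i := fun i =>
    resolutionD_tens_one _ (by
      rw [map_sub, kd3_apply]
      refine sub_eq_zero.2 (((congrFun hm i).symm).trans ?_)
      rw [kd3_apply, ← hw3, ← hD])
  let u2 : Fin n → SymChains k n (j + 2) := fun i =>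
    s (j + 1) (w2 i - kd3 (chainX k n (j + 1)) w3 i)
  have h1 : ∀ i, D (j + 2) (s (j + 2) (w1 i - kd2 (chainX k n (j + 2)) u2 i)) =
      w1 i - kd2 (chainX k n (j + 2)) u2 i := fun i =>
    resolutionD_tens_one _ (by
      rw [map_sub]
      refine sub_eq_zero.2 (((congrFun hw2 i).symm).trans ?_)
      refine Eq.trans ?_ (map_kd2 (hD (j + 1)) u2 i).symm
      rw [show (fun i => D (j + 1) (u2 i)) = w2 - kd3 (chainX k n (j + 1)) w3 from funext h2,
        map_sub, kd2_kd3 (cubic_chainX (j + 1)), sub_zero])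
  let u1 : Fin n → SymChains k n (j + 3) := fun i =>
    s (j + 2) (w1 i - kd2 (chainX k n (j + 2)) u2 i)
  have h0 : D (j + 3) (s (j + 3) (s (j + 2) z - kd1 (chainX k n (j + 3)) u1)) =
      s (j + 2) z - kd1 (chainX k n (j + 3)) u1 :=
    resolutionD_tens_one _ (by
      rw [map_sub]
      refine sub_eq_zero.2 (hw1.trans ?_)
      refine Eq.trans ?_ (map_kd1 (hD (j + 2)) u1).symm
      rw [show (fun i => D (j + 2) (u1 i)) = w1 - kd2 (chainX k n (j + 2)) u2 from funext h1,
        map_sub, kd1_kd2 (cubic_chainX (j + 2)), sub_zero])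
  refine ⟨augmentFirst k (Ym k n) (Sym k n) (j + 3)
    (s (j + 3) (s (j + 2) z - kd1 (chainX k n (j + 3)) u1)), ?_⟩
  rw [← augmentFirst_resolutionD]
  refine (congrArg _ h0).trans ?_
  rw [map_sub, augmentFirst_kd1, sub_zero, augmentFirst_tens_one]

theorem subsingleton_H (hn : 2 ≤ n) (i : ℕ) (hi : 2 ≤ i) : Subsingleton (H k n i) := by
  obtain ⟨j, rfl⟩ := Nat.exists_eq_add_of_le' hi
  refine Submodule.Quotient.subsingleton_iff.2 (eq_top_iff.2 fun z _ => ?_)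
  obtain ⟨u, hu⟩ := exists_boundary_eq hn j z.1 z.2
  exact ⟨u, hu⟩

end Vanishing

section Components

/-! ### Homogeneous components in the Koszul complex of the symmetric algebra -/

variable {k : Type u} [Field k] {n : ℕ}

theorem homogeneousComponent_succ_X_mul (d : ℕ) (i : Fin n) (f : Sym k n) :
    MvPolynomial.homogeneousComponent (d + 1) (MvPolynomial.X i * f) =
      MvPolynomial.X i * MvPolynomial.homogeneousComponent d f := by
  ext m
  rw [MvPolynomial.coeff_homogeneousComponent, MvPolynomial.coeff_X_mul',
    MvPolynomial.coeff_X_mul', MvPolynomial.coeff_homogeneousComponent]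
  by_cases hm : i ∈ m.support
  · have hle : Finsupp.single i 1 ≤ m := by
      rw [Finsupp.single_le_iff]
      exact Nat.one_le_iff_ne_zero.2 (Finsupp.mem_support_iff.1 hm)
    have hd : m.degree = (m - Finsupp.single i 1).degree + 1 := by
      conv_lhs => rw [← tsub_add_cancel_of_le hle]
      rw [map_add, Finsupp.degree_single]
    simp [hm, hd]
  · simp [hm]

theorem homogeneousComponent_zero_X_mul (i : Fin n) (f : Sym k n) :
    MvPolynomial.homogeneousComponent 0 (MvPolynomial.X i * f) = 0 := by
  rw [MvPolynomial.homogeneousComponent_zero]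
  have h : MvPolynomial.constantCoeff (MvPolynomial.X i * f) = 0 := by simp
  rw [MvPolynomial.constantCoeff_eq] at h
  rw [h, map_zero]

/-- The homogeneous component of degree `d` of a family. -/
def famComponent (k : Type u) [Field k] (n d : ℕ) : (Fin n → Sym k n) →ₗ[k] (Fin n → Sym k n) :=
  LinearMap.pi fun i => (MvPolynomial.homogeneousComponent d).comp (LinearMap.proj i)

theorem famComponent_apply (d : ℕ) (w : Fin n → Sym k n) (i : Fin n) :
    famComponent k n d w i = MvPolynomial.homogeneousComponent d (w i) := rfl

theorem mem_koszulDegree {p : ℕ} {w : Fin n → Sym k n} :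
    w ∈ koszulDegree k n p ↔ ∀ i, (w i).IsHomogeneous p := by
  simp [koszulDegree, Submodule.mem_pi]

theorem famComponent_mem (d : ℕ) (w : Fin n → Sym k n) :
    famComponent k n d w ∈ koszulDegree k n d :=
  mem_koszulDegree.2 fun _ => MvPolynomial.homogeneousComponent_isHomogeneous _ _

theorem famComponent_of_mem {p d : ℕ} {w : Fin n → Sym k n} (hw : w ∈ koszulDegree k n p) :
    famComponent k n d w = if d = p then w else 0 := by
  funext i
  rw [famComponent_apply, MvPolynomial.homogeneousComponent_of_mem (mem_koszulDegree.1 hw i)]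
  split_ifs <;> rfl

theorem homogeneousComponent_kd1 (d : ℕ) (w : Fin n → Sym k n) :
    MvPolynomial.homogeneousComponent (d + 1) (kd1 (symX k n) w) =
      kd1 (symX k n) (famComponent k n d w) := by
  simp only [kd1_apply, symX_apply, map_sum, homogeneousComponent_succ_X_mul, famComponent_apply]

theorem famComponent_kd2 (d : ℕ) (w : Fin n → Sym k n) :
    famComponent k n (d + 2) (kd2 (symX k n) w) = kd2 (symX k n) (famComponent k n d w) := by
  funext i
  simp only [famComponent_apply, kd2_apply, symX_apply, map_sum, map_add, map_sub,
    homogeneousComponent_succ_X_mul]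

theorem famComponent_kd2_of_lt {d : ℕ} (hd : d < 2) (w : Fin n → Sym k n) :
    famComponent k n d (kd2 (symX k n) w) = 0 := by
  funext i
  interval_cases d <;> simp only [famComponent_apply, kd2_apply, symX_apply, map_sum, map_add,
    map_sub, homogeneousComponent_succ_X_mul, homogeneousComponent_zero_X_mul, mul_zero, sub_zero,
    add_zero, Finset.sum_const_zero, Pi.zero_apply]

theorem sum_famComponent (w : Fin n → Sym k n) : ∃ N, ∑ d ∈ Finset.range N,
    famComponent k n d w = w := by
  refine ⟨Finset.univ.sup (fun i => (w i).totalDegree) + 1, funext fun i => ?_⟩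
  rw [Finset.sum_apply]
  simp only [famComponent_apply]
  conv_rhs => rw [← MvPolynomial.sum_homogeneousComponent (w i)]
  symm
  refine Finset.sum_subset (Finset.range_mono (Nat.succ_le_succ
    (Finset.le_sup (f := fun i => (w i).totalDegree) (Finset.mem_univ i)))) fun d _ hd => ?_
  exact MvPolynomial.homogeneousComponent_eq_zero _ _ (by simpa using hd)

theorem koszulD1_eq : koszulD1 k n = kd1 (symX k n) := rfl

theorem koszulD2_eq : koszulD2 k n = kd2 (symX k n) := by
  refine LinearMap.pi_ext fun j m => ?_
  rw [kd2_single]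
  simp only [koszulD2, LinearMap.sum_apply, LinearMap.comp_apply, LinearMap.proj_apply]
  rw [Finset.sum_eq_single j (fun l _ hl => by simp [hl]) (by simp)]
  refine Finset.sum_congr rfl fun i _ => ?_
  simp only [Pi.single_eq_same, LinearMap.sub_apply, LinearMap.comp_apply, LinearMap.single_apply,
    LinearMap.mulLeft_apply, symX_apply]
  rw [mul_left_comm (MvPolynomial.X i) (MvPolynomial.X j) m, sub_self, Pi.single_zero, zero_sub,
    neg_sub, ← mul_assoc, ← mul_assoc, pow_two]

theorem mem_koszulBoundaries {p : ℕ} {w : Fin n → Sym k n} (hw : w ∈ koszulDegree k n p) :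
    w ∈ koszulBoundaries k n p ↔ w ∈ LinearMap.range (kd2 (symX k n)) := by
  constructor
  · match p with
    | 0 => rintro rfl; exact Submodule.zero_mem _
    | 1 => rintro rfl; exact Submodule.zero_mem _
    | p + 2 =>
      rintro ⟨v, -, rfl⟩
      rw [koszulD2_eq]
      exact ⟨v, rfl⟩
  · rintro ⟨v, rfl⟩
    have h := famComponent_of_mem (d := p) hw
    rw [if_pos rfl] at h
    match p with
    | 0 => rw [famComponent_kd2_of_lt (by omega)] at h; exact h.symm
    | 1 => rw [famComponent_kd2_of_lt (by omega)] at h; exact h.symm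
    | p + 2 =>
      rw [famComponent_kd2] at h
      rw [← h, ← koszulD2_eq]
      exact ⟨_, famComponent_mem p v, rfl⟩

theorem koszulBoundaries_le (p : ℕ) : koszulBoundaries k n p ≤ koszulCycles k n p := by
  match p with
  | 0 => exact bot_le
  | 1 => exact bot_le
  | p + 2 =>
    rintro _ ⟨v, hv, rfl⟩
    rw [koszulD2_eq]
    have h := famComponent_of_mem (d := p) hv
    rw [if_pos rfl] at h
    refine ⟨?_, kd1_kd2 cubic_symX v⟩
    rw [← h, ← famComponent_kd2]
    exact famComponent_mem _ _

theorem exists_kd1_symX (m : Sym k n) :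
    ∃ w, m = MvPolynomial.C (MvPolynomial.constantCoeff m) + kd1 (symX k n) w := by
  induction m using MvPolynomial.induction_on with
  | C a => exact ⟨0, by simp⟩
  | add p q hp hq =>
    obtain ⟨v, hv⟩ := hp
    obtain ⟨w, hw⟩ := hq
    refine ⟨v + w, ?_⟩
    conv_lhs => rw [hv, hw]
    rw [map_add, map_add, map_add]
    abel
  | mul_X p i _ =>
    refine ⟨Pi.single i p, ?_⟩
    rw [kd1_apply, Finset.sum_eq_single i (fun l _ hl => by simp [hl]) (by simp),
      Pi.single_eq_same, symX_apply, map_mul, MvPolynomial.constantCoeff_X, mul_zero, map_zero,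
      zero_add, mul_comm]

end Components

section LowDegrees

/-! ### Homology in degrees zero and one -/

variable {k : Type u} [Field k] {n : ℕ}

theorem leftAction_zero_eq (a : Env k n) :
    (leftAction k (Ym k n) (Sym k n) 0 a : Module.End k (Sym k n)) =
      envLift (symX k n) cubic_symX a := by
  have h : envAction k (Ym k n) (Sym k n) = envLift (symX k n) cubic_symX :=
    env_hom_ext fun i => by
      rw [envLift_envX]
      exact LinearMap.ext fun m => chainX_zero i m
  exact DFunLike.congr_fun h a

/-- The `1`-chain `a ⊗ m`, with `m` regarded as a polynomial. -/
def oneChain (k : Type u) [Field k] (n : ℕ) : Env k n →ₗ[k] Sym k n →ₗ[k] SymChains k n 1 :=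
  tens k (Ym k n) (Sym k n) 0

/-- The boundary of `1`-chains, with values in the polynomials. -/
def boundaryZero (k : Type u) [Field k] (n : ℕ) : SymChains k n 1 →ₗ[k] Sym k n :=
  boundary k (Ym k n) (Sym k n) 0

/-- The boundary of `2`-chains. -/
abbrev boundaryOne (k : Type u) [Field k] (n : ℕ) : SymChains k n 2 →ₗ[k] SymChains k n 1 :=
  boundary k (Ym k n) (Sym k n) 1

theorem oneChain_ext {N : Type u} [AddCommGroup N] [Module k N] {f f' : SymChains k n 1 →ₗ[k] N}
    (h : ∀ a m, f (oneChain k n a m) = f' (oneChain k n a m)) : f = f' :=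
  chains_ext h

theorem boundaryZero_oneChain (a : Env k n) (m : Sym k n) :
    boundaryZero k n (oneChain k n a m) =
      augmentation k (Ym k n) a • m - envLift (symX k n) cubic_symX a m := by
  rw [← leftAction_zero_eq]
  rfl

theorem boundaryOne_tens (a b : Env k n) (m : Sym k n) :
    boundaryOne k n
        (tens k (Ym k n) (Sym k n) 1 a (oneChain k n b m)) =
      augmentation k (Ym k n) a • oneChain k n b m -
        (oneChain k n (a * b) m -
          oneChain k n a (envLift (symX k n) cubic_symX b m)) := by
  rw [← leftAction_zero_eq]
  rfl

theorem constantCoeff_envLift (a : Env k n) (m : Sym k n) :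
    MvPolynomial.constantCoeff (envLift (symX k n) cubic_symX a m) =
      augmentation k (Ym k n) a * MvPolynomial.constantCoeff m := by
  induction a using env_induction with
  | one => simp
  | add a b ha hb => simp [ha, hb, add_mul]
  | smul c a ha =>
    rw [map_smul, LinearMap.smul_apply, MvPolynomial.smul_eq_C_mul, map_mul, ha]
    simp [mul_assoc]
  | mul i a _ =>
    rw [map_mul, Module.End.mul_apply, envLift_envX, symX_apply, map_mul, map_mul,
      augmentation_envX]
    simp

variable (k n) in
theorem nonempty_H_zero_equiv : Nonempty (H k n 0 ≃ₗ[k] k) := by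
  let c : Sym k n →ₗ[k] k :=
    { toFun := fun m => MvPolynomial.constantCoeff m
      map_add' := map_add _
      map_smul' := fun t m => by
        rw [MvPolynomial.smul_eq_C_mul, map_mul, MvPolynomial.constantCoeff_C]
        rfl }
  let f : cycles k (Ym k n) (Sym k n) 0 →ₗ[k] k := c.comp (Submodule.subtype _)
  have hsurj : Function.Surjective f := fun t =>
    ⟨⟨(MvPolynomial.C t : Sym k n), trivial⟩, MvPolynomial.constantCoeff_C _ t⟩
  have hker : (LinearMap.range (boundary k (Ym k n) (Sym k n) 0)).submoduleOf
      (cycles k (Ym k n) (Sym k n) 0) = LinearMap.ker f := by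
    refine le_antisymm ?_ fun m hm => ?_
    · rintro ⟨_, -⟩ ⟨z, rfl⟩
      change c (boundaryZero k n z) = 0
      suffices h : c.comp (boundaryZero k n) = 0 from LinearMap.congr_fun h z
      refine oneChain_ext fun a x => ?_
      rw [LinearMap.comp_apply, boundaryZero_oneChain, map_sub, LinearMap.zero_apply, sub_eq_zero]
      exact (map_smul c _ _).trans (constantCoeff_envLift a x).symm
    · obtain ⟨w, hw⟩ := exists_kd1_symX (m.1 : Sym k n)
      have hm0 : MvPolynomial.constantCoeff (m.1 : Sym k n) = 0 := hm
      rw [hm0, map_zero, zero_add, kd1_apply] at hw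
      refine ⟨-∑ i, oneChain k n (envX k n i) (w i), ?_⟩
      refine Eq.trans ?_ hw.symm
      change boundaryZero k n _ = _
      rw [map_neg, map_sum, ← Finset.sum_neg_distrib]
      refine Finset.sum_congr rfl fun i _ => ?_
      rw [boundaryZero_oneChain, augmentation_envX, zero_smul, zero_sub, envLift_envX]
      exact neg_neg _
  exact ⟨(Submodule.quotEquivOfEq _ _ hker).trans (f.quotKerEquivOfSurjective hsurj)⟩

/-- `koszulChain` as a linear map. -/
def koszulChainₗ (k : Type u) [Field k] (n : ℕ) : (Fin n → Sym k n) →ₗ[k] SymChains k n 1 :=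
  ∑ i, (oneChain k n (envX k n i)).comp (LinearMap.proj i)

theorem koszulChainₗ_apply (w : Fin n → Sym k n) : koszulChainₗ k n w = koszulChain k n w := by
  simp only [koszulChainₗ, LinearMap.sum_apply, LinearMap.comp_apply]
  rfl

theorem koszulChainₗ_single (i : Fin n) (m : Sym k n) :
    koszulChainₗ k n (Pi.single i m) = oneChain k n (envX k n i) m := by
  simp only [koszulChainₗ, LinearMap.sum_apply, LinearMap.comp_apply, LinearMap.proj_apply]
  rw [Finset.sum_eq_single i (fun l _ hl => by rw [Pi.single_eq_of_ne hl]; exact map_zero _)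
    (by simp), Pi.single_eq_same]

theorem boundary_koszulChainₗ (w : Fin n → Sym k n) :
    boundaryZero k n (koszulChainₗ k n w) = -koszulD1 k n w := by
  suffices h : (boundaryZero k n).comp (koszulChainₗ k n) = -koszulD1 k n from
    LinearMap.congr_fun h w
  refine LinearMap.pi_ext fun i m => ?_
  rw [LinearMap.comp_apply, koszulChainₗ_single, boundaryZero_oneChain, augmentation_envX,
    zero_smul, zero_sub, envLift_envX, LinearMap.neg_apply, koszulD1_eq, kd1_apply,
    Finset.sum_eq_single i (fun l _ hl => by simp [hl]) (by simp), Pi.single_eq_same]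

/-- The Fox derivative as a map on `1`-chains, with values in the cokernel of the Koszul
differential. It inverts `koszulChain` up to boundaries. -/
def foxChain (k : Type u) [Field k] (n : ℕ) : SymChains k n 1 →ₗ[k] FoxModule (symX k n) :=
  liftTens k (Ym k n) (Sym k n) (i := 0)
    (fox cubic_symX : Env k n →ₗ[k] Sym k n →ₗ[k] FoxModule (symX k n))

theorem foxChain_tens (a : Env k n) (m : Sym k n) :
    foxChain k n (oneChain k n a m) = fox cubic_symX a m := rfl

theorem foxChain_boundary (z : SymChains k n 2) :
    foxChain k n (boundaryOne k n z) = 0 := by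
  suffices h : (foxChain k n).comp (boundaryOne k n) = 0 from
    LinearMap.congr_fun h z
  refine chains_ext fun a y => ?_
  suffices h : ((foxChain k n).comp (boundaryOne k n)).comp
      (tens k (Ym k n) (Sym k n) 1 a) = 0 from LinearMap.congr_fun h y
  refine oneChain_ext fun b m => ?_
  rw [LinearMap.comp_apply, LinearMap.comp_apply, boundaryOne_tens, map_sub, map_sub, map_smul,
    foxChain_tens, foxChain_tens, foxChain_tens, fox_mul, LinearMap.zero_apply]
  abel

theorem foxChain_koszulChainₗ (w : Fin n → Sym k n) :
    foxChain k n (koszulChainₗ k n w) = Submodule.Quotient.mk w := by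
  suffices h : (foxChain k n).comp (koszulChainₗ k n) = Submodule.mkQ _ from
    LinearMap.congr_fun h w
  refine LinearMap.pi_ext fun i m => ?_
  rw [LinearMap.comp_apply, koszulChainₗ_single, foxChain_tens, fox_envX]
  rfl

/-- Up to sign, the difference `xᵢ b ⊗ m - xᵢ ⊗ b m` is the boundary of `xᵢ ⊗ b ⊗ m`, since the
augmentation kills `xᵢ`. -/
theorem tens_envX_sub_mem (i : Fin n) (b : Env k n) (m : Sym k n) :
    oneChain k n (envX k n i * b) m - koszulChainₗ k n
      (Pi.single i (envLift (symX k n) cubic_symX b m)) ∈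
        LinearMap.range (boundaryOne k n) := by
  refine ⟨-tens k (Ym k n) (Sym k n) 1 (envX k n i) (oneChain k n b m), ?_⟩
  rw [map_neg, boundaryOne_tens, augmentation_envX, zero_smul, koszulChainₗ_single]
  abel

theorem tens_one_mem (m : Sym k n) : oneChain k n 1 m ∈
    LinearMap.range (boundaryOne k n) := by
  refine ⟨tens k (Ym k n) (Sym k n) 1 1 (oneChain k n 1 m), ?_⟩
  rw [boundaryOne_tens, map_one (augmentation k (Ym k n)), one_smul, mul_one,
    map_one (envLift (symX k n) cubic_symX), Module.End.one_apply, sub_self,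
    sub_zero]

theorem koszulChainₗ_kd2_mem (v : Fin n → Sym k n) : koszulChainₗ k n (kd2 (symX k n) v) ∈
    LinearMap.range (boundaryOne k n) := by
  suffices h : (Submodule.mkQ (LinearMap.range (boundaryOne k n))).comp
      ((koszulChainₗ k n).comp (kd2 (symX k n))) = 0 from
    (Submodule.Quotient.mk_eq_zero _).1 (LinearMap.congr_fun h v)
  refine LinearMap.pi_ext fun j m => ?_
  have hmk : ∀ (i : Fin n) (b : Env k n),
      Submodule.mkQ (LinearMap.range (boundaryOne k n))
        (koszulChainₗ k n (Pi.single i (envLift (symX k n) cubic_symX b m))) =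
      Submodule.mkQ (LinearMap.range (boundaryOne k n))
        (oneChain k n (envX k n i * b) m) := fun i b =>
    ((Submodule.Quotient.eq _).2 (tens_envX_sub_mem i b m)).symm
  have hXX : ∀ i l, symX k n i (symX k n l m) =
      envLift (symX k n) cubic_symX (envX k n i * envX k n l) m := fun i l => by
    rw [map_mul, Module.End.mul_apply, envLift_envX, envLift_envX]
  have hc : oneChain k n (cubic (envX k n) j) m = 0 := by
    rw [cubic_envX, map_zero, LinearMap.zero_apply]
  rw [LinearMap.comp_apply, LinearMap.comp_apply, kd2_single, LinearMap.zero_apply,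
    ← map_zero (Submodule.mkQ (LinearMap.range (boundaryOne k n))), ← hc]
  simp only [cubic, hXX, Pi.single_sub, map_sum, map_sub, hmk, LinearMap.sum_apply,
    LinearMap.sub_apply, mul_sub, sub_mul, mul_assoc]

/-- Every `1`-chain is homologous to one of the form `∑ xᵢ ⊗ wᵢ`. -/
theorem exists_sub_koszulChainₗ_mem (z : SymChains k n 1) : ∃ w, z - koszulChainₗ k n w ∈
    LinearMap.range (boundaryOne k n) := by
  suffices h : (LinearMap.range (koszulChainₗ k n) ⊔
      LinearMap.range (boundaryOne k n)) = ⊤ by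
    obtain ⟨_, ⟨w, rfl⟩, y, hy, rfl⟩ := Submodule.mem_sup.1 (h ▸ Submodule.mem_top : z ∈ _)
    exact ⟨w, by rwa [add_sub_cancel_left]⟩
  rw [← Submodule.ker_mkQ (LinearMap.range (koszulChainₗ k n) ⊔ _), LinearMap.ker_eq_top]
  refine oneChain_ext fun a m => (Submodule.Quotient.mk_eq_zero _).2 ?_
  induction a using env_induction with
  | one => exact Submodule.mem_sup_right (tens_one_mem m)
  | add a b ha hb => rw [map_add, LinearMap.add_apply]; exact Submodule.add_mem _ ha hb
  | smul c a ha => rw [map_smul, LinearMap.smul_apply]; exact Submodule.smul_mem _ c ha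
  | mul i b _ =>
    rw [← sub_add_cancel (oneChain k n (envX k n i * b) m) (koszulChainₗ k n
      (Pi.single i (envLift (symX k n) cubic_symX b m)))]
    exact Submodule.add_mem _ (Submodule.mem_sup_right (tens_envX_sub_mem i b m))
      (Submodule.mem_sup_left ⟨_, rfl⟩)

/-- Induction for the homogeneous components of the Yang-Mills algebra. -/
theorem envDegree_induction {i : ℕ} {P : Submodule k (Env k n)}
    (h : ∀ l, ∀ b ∈ envDegree k n i, envX k n l * b ∈ P) : envDegree k n (i + 1) ≤ P := by
  rw [envDegree, pow_succ', Submodule.mul_le]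
  intro x hx b hb
  induction hx using Submodule.span_induction with
  | mem x hx => obtain ⟨l, rfl⟩ := hx; exact h l b hb
  | zero => rw [zero_mul]; exact P.zero_mem
  | add x y _ _ hx hy => rw [add_mul]; exact P.add_mem hx hy
  | smul c x _ hx => rw [smul_mul_assoc]; exact P.smul_mem c hx

theorem isHomogeneous_envLift {i : ℕ} {a : Env k n} (ha : a ∈ envDegree k n i) {j : ℕ}
    {m : Sym k n} (hm : m.IsHomogeneous j) :
    (envLift (symX k n) cubic_symX a m : Sym k n).IsHomogeneous (i + j) := by
  induction i generalizing a with
  | zero =>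
    rw [envDegree, pow_zero] at ha
    obtain ⟨c, rfl⟩ := Submodule.mem_one.1 ha
    rw [AlgHom.commutes, Module.algebraMap_end_apply, zero_add]
    exact (MvPolynomial.homogeneousSubmodule (Fin n) k j).smul_mem c hm
  | succ i ih =>
    refine envDegree_induction (P := (MvPolynomial.homogeneousSubmodule (Fin n) k
      (i + 1 + j)).comap ((LinearMap.applyₗ m).comp (envLift (symX k n) cubic_symX).toLinearMap))
      (fun l b hb => ?_) ha
    change ((envLift (symX k n) cubic_symX (envX k n l * b)) m : Sym k n).IsHomogeneous _
    rw [map_mul, Module.End.mul_apply, envLift_envX, symX_apply]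
    have := (MvPolynomial.isHomogeneous_X k l).mul (ih hb)
    rwa [← add_assoc, add_comm 1 i] at this

theorem exists_sub_koszulChainₗ_mem_of_mem {p : ℕ} {z : SymChains k n 1}
    (hz : z ∈ chainsDegree k n (p + 1)) : ∃ w ∈ koszulDegree k n p, z - koszulChainₗ k n w ∈
      LinearMap.range (boundaryOne k n) := by
  suffices h : chainsDegree k n (p + 1) ≤ (koszulDegree k n p).map (koszulChainₗ k n) ⊔
      LinearMap.range (boundaryOne k n) by
    obtain ⟨_, ⟨w, hw, rfl⟩, y, hy, rfl⟩ := Submodule.mem_sup.1 (h hz)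
    exact ⟨w, hw, by rwa [add_sub_cancel_left]⟩
  refine Submodule.span_le.2 ?_
  rintro _ ⟨i, j, hij, a, ha, m, hm, rfl⟩
  change oneChain k n a m ∈ (koszulDegree k n p).map (koszulChainₗ k n) ⊔
    LinearMap.range (boundaryOne k n)
  cases i with
  | zero =>
    rw [envDegree, pow_zero] at ha
    obtain ⟨c, rfl⟩ := Submodule.mem_one.1 ha
    rw [Algebra.algebraMap_eq_smul_one, map_smul, LinearMap.smul_apply]
    exact Submodule.smul_mem _ c (Submodule.mem_sup_right (tens_one_mem m))
  | succ i =>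
    refine envDegree_induction (P := ((koszulDegree k n p).map (koszulChainₗ k n) ⊔
      LinearMap.range (boundaryOne k n)).comap
        ((oneChain k n).flip m)) (fun l b hb => ?_) ha
    rw [Submodule.mem_comap, LinearMap.flip_apply]
    rw [← sub_add_cancel (oneChain k n (envX k n l * b) m) (koszulChainₗ k n
      (Pi.single l (envLift (symX k n) cubic_symX b m)))]
    refine Submodule.add_mem _ (Submodule.mem_sup_right (tens_envX_sub_mem l b m))
      (Submodule.mem_sup_left ⟨_, mem_koszulDegree.2 fun l' => ?_, rfl⟩)
    obtain rfl | hl := eq_or_ne l' l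
    · rw [Pi.single_eq_same]
      have := isHomogeneous_envLift hb hm
      rwa [show i + j = p by omega] at this
    · rw [Pi.single_eq_of_ne hl]
      exact MvPolynomial.isHomogeneous_zero _ _ _

theorem koszulChainₗ_mem_chainsDegree {p : ℕ} {w : Fin n → Sym k n}
    (hw : w ∈ koszulDegree k n p) : koszulChainₗ k n w ∈ chainsDegree k n (p + 1) := by
  rw [koszulChainₗ_apply]
  refine Submodule.sum_mem _ fun i _ => Submodule.subset_span
    ⟨1, p, add_comm 1 p, _, ?_, w i, mem_koszulDegree.1 hw i, rfl⟩
  rw [envDegree, pow_one]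
  exact Submodule.subset_span ⟨i, rfl⟩

end LowDegrees

section HomologyOne

/-! ### The first homology and its grading -/

variable {k : Type u} [Field k] {n : ℕ}

theorem koszulChainₗ_mem_cycles {w : Fin n → Sym k n} (hw : koszulD1 k n w = 0) :
    koszulChainₗ k n w ∈ cycles k (Ym k n) (Sym k n) 1 := by
  change boundaryZero k n (koszulChainₗ k n w) = 0
  rw [boundary_koszulChainₗ, hw, neg_zero]

/-- The class in `H_1` of the cycle `∑ xᵢ ⊗ wᵢ` given by a Koszul cycle `w`. -/
def koszulClass (k : Type u) [Field k] (n : ℕ) : LinearMap.ker (koszulD1 k n) →ₗ[k] H k n 1 :=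
  (Submodule.mkQ _).comp (LinearMap.restrict (koszulChainₗ k n)
    (p := LinearMap.ker (koszulD1 k n)) (q := cycles k (Ym k n) (Sym k n) 1)
    fun _ hw => koszulChainₗ_mem_cycles hw)

theorem koszulClass_apply (w : LinearMap.ker (koszulD1 k n)) : koszulClass k n w =
    Submodule.Quotient.mk ⟨koszulChainₗ k n w, koszulChainₗ_mem_cycles w.2⟩ := rfl

/-- The map on `H_1` induced by the Fox derivative. -/
def foxClass (k : Type u) [Field k] (n : ℕ) : H k n 1 →ₗ[k] FoxModule (symX k n) :=
  Submodule.liftQ _ ((foxChain k n).comp (Submodule.subtype _)) (by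
    rintro ⟨_, -⟩ ⟨z, rfl⟩
    exact foxChain_boundary z)

theorem foxClass_koszulClass (w : LinearMap.ker (koszulD1 k n)) :
    foxClass k n (koszulClass k n w) = Submodule.Quotient.mk w.1 :=
  foxChain_koszulChainₗ w.1

theorem koszulClass_eq_mk {z : cycles k (Ym k n) (Sym k n) 1} {w : Fin n → Sym k n}
    (h : z.1 - koszulChainₗ k n w ∈ LinearMap.range (boundaryOne k n)) :
    ∃ hw : koszulD1 k n w = 0, koszulClass k n ⟨w, hw⟩ = Submodule.Quotient.mk z := by
  have hw : koszulD1 k n w = 0 := by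
    obtain ⟨u, hu⟩ := h
    have h0 : boundaryZero k n (z.1 - koszulChainₗ k n w) = 0 := by
      rw [← hu]
      exact boundary_boundary k (Ym k n) (Sym k n) 0 u
    rw [map_sub, boundary_koszulChainₗ, sub_neg_eq_add,
      show boundaryZero k n z.1 = 0 from z.2, zero_add] at h0
    exact h0
  refine ⟨hw, ?_⟩
  rw [koszulClass_apply, eq_comm, Submodule.Quotient.eq]
  exact h

theorem koszulClass_surjective : Function.Surjective (koszulClass k n) := fun x => by
  obtain ⟨z, rfl⟩ := Submodule.Quotient.mk_surjective _ x
  obtain ⟨w, hw⟩ := exists_sub_koszulChainₗ_mem z.1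
  obtain ⟨hw0, h⟩ := koszulClass_eq_mk hw
  exact ⟨_, h⟩

theorem koszulClass_eq_zero_iff (w : LinearMap.ker (koszulD1 k n)) :
    koszulClass k n w = 0 ↔ w.1 ∈ LinearMap.range (kd2 (symX k n)) := by
  constructor
  · intro h
    rw [← Submodule.Quotient.mk_eq_zero, ← foxClass_koszulClass, h, map_zero]
  · rintro ⟨v, hv⟩
    rw [koszulClass_apply, Submodule.Quotient.mk_eq_zero]
    change koszulChainₗ k n w.1 ∈ LinearMap.range (boundaryOne k n)
    rw [← hv]
    exact koszulChainₗ_kd2_mem v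

theorem foxClass_injective : Function.Injective (foxClass k n) := by
  rw [injective_iff_map_eq_zero]
  intro x hx
  obtain ⟨w, rfl⟩ := koszulClass_surjective x
  rw [foxClass_koszulClass, Submodule.Quotient.mk_eq_zero] at hx
  exact (koszulClass_eq_zero_iff w).2 hx

/-- The restriction of `koszulClass` to cycles of degree `p`. -/
def koszulClassDegree (k : Type u) [Field k] (n p : ℕ) : koszulCycles k n p →ₗ[k] H k n 1 :=
  (koszulClass k n).comp (Submodule.inclusion inf_le_right)

theorem range_koszulClassDegree (p : ℕ) :
    LinearMap.range (koszulClassDegree k n p) = H1 k n p := by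
  refine le_antisymm ?_ ?_
  · rintro _ ⟨w, rfl⟩
    exact ⟨⟨koszulChainₗ k n w, koszulChainₗ_mem_cycles w.2.2⟩,
      koszulChainₗ_mem_chainsDegree w.2.1, rfl⟩
  · rintro _ ⟨z, hz, rfl⟩
    obtain ⟨w, hw, hwz⟩ := exists_sub_koszulChainₗ_mem_of_mem hz
    obtain ⟨hw0, h⟩ := koszulClass_eq_mk hwz
    exact ⟨⟨w, hw, hw0⟩, h⟩

theorem ker_koszulClassDegree (p : ℕ) : LinearMap.ker (koszulClassDegree k n p) =
    (koszulBoundaries k n p).submoduleOf (koszulCycles k n p) := by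
  ext w
  refine (koszulClass_eq_zero_iff _).trans ?_
  exact (mem_koszulBoundaries w.2.1).symm

/-- The isomorphism from the Koszul homology onto the graded piece of `H_1`. -/
def koszulEquiv (k : Type u) [Field k] (n p : ℕ) : KoszulH1 k n p ≃ₗ[k] H1 k n p :=
  ((Submodule.quotEquivOfEq _ _ (ker_koszulClassDegree p).symm).trans
    (koszulClassDegree k n p).quotKerEquivRange).trans
      (LinearEquiv.ofEq _ _ (range_koszulClassDegree p))

theorem koszulEquiv_mk (p : ℕ) (w : koszulCycles k n p) :
    (koszulEquiv k n p (Submodule.Quotient.mk w) : H k n 1) = koszulClassDegree k n p w := rfl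

/-- Projection of the cokernel of the Koszul differential to the degree `p` component. -/
def foxComponent (k : Type u) [Field k] (n p : ℕ) :
    FoxModule (symX k n) →ₗ[k] FoxModule (symX k n) :=
  Submodule.mapQ _ _ (famComponent k n p) (by
    rintro _ ⟨v, rfl⟩
    obtain hp | hp := lt_or_ge p 2
    · rw [Submodule.mem_comap, famComponent_kd2_of_lt hp]
      exact Submodule.zero_mem _
    · obtain ⟨p, rfl⟩ := Nat.exists_eq_add_of_le' hp
      exact ⟨famComponent k n p v, (famComponent_kd2 p v).symm⟩)

theorem foxComponent_foxClass {p d : ℕ} {x : H k n 1} (hx : x ∈ H1 k n p) :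
    foxComponent k n d (foxClass k n x) = if d = p then foxClass k n x else 0 := by
  rw [← range_koszulClassDegree] at hx
  obtain ⟨w, rfl⟩ := hx
  have h : foxClass k n (koszulClassDegree k n p w) = Submodule.Quotient.mk w.1 :=
    foxClass_koszulClass _
  rw [h]
  change Submodule.Quotient.mk (famComponent k n d w.1) = _
  rw [famComponent_of_mem w.2.1]
  split_ifs <;> rfl

theorem isInternal_H1 : DirectSum.IsInternal (fun p : ℕ => H1 k n p) := by
  refine DirectSum.isInternal_submodule_of_iSupIndep_of_iSup_eq_top (fun p => ?_) ?_
  · rw [Submodule.disjoint_def]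
    intro x hx hx'
    have hle : ⨆ (q : ℕ) (_ : q ≠ p), H1 k n q ≤
        LinearMap.ker ((foxComponent k n p).comp (foxClass k n)) :=
      iSup₂_le fun q hq y hy => by
        rw [LinearMap.mem_ker, LinearMap.comp_apply, foxComponent_foxClass hy, if_neg hq.symm]
    have h0 := hle hx'
    rw [LinearMap.mem_ker, LinearMap.comp_apply, foxComponent_foxClass hx, if_pos rfl] at h0
    exact foxClass_injective (h0.trans (map_zero _).symm)
  · refine eq_top_iff.2 fun x _ => ?_
    obtain ⟨w, rfl⟩ := koszulClass_surjective x
    obtain ⟨N, hN⟩ := sum_famComponent w.1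
    have hker : ∀ d, koszulD1 k n (famComponent k n d w.1) = 0 := fun d => by
      have hw : kd1 (symX k n) w.1 = 0 := w.2
      change kd1 (symX k n) _ = 0
      rw [← homogeneousComponent_kd1, hw, map_zero]
    have hw : w = ∑ d ∈ Finset.range N, ⟨famComponent k n d w.1, hker d⟩ :=
      Subtype.ext (by simpa using hN.symm)
    rw [hw, map_sum]
    refine Submodule.sum_mem _ fun d _ => Submodule.mem_iSup_of_mem d ?_
    rw [← range_koszulClassDegree]
    exact ⟨⟨_, famComponent_mem d w.1, hker d⟩, rfl⟩

end HomologyOne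

section Dimension

/-! ### Dimensions -/

variable {k : Type u} [Field k] {n : ℕ}

theorem finrank_homogeneousSubmodule (hn : 1 ≤ n) (p : ℕ) :
    (Module.finrank k (MvPolynomial.homogeneousSubmodule (Fin n) k p) : ℚ) =
      ((n + p - 1)! : ℚ) / ((n - 1)! * p !) := by
  have h1 : MvPolynomial.homogeneousSubmodule (Fin n) k p =
      MvPolynomial.restrictSupport k {d : Fin n →₀ ℕ | d.degree = p} :=
    MvPolynomial.homogeneousSubmodule_eq_finsupp_supported (Fin n) k p
  have h2 : ({d : Fin n →₀ ℕ | d.degree = p} : Set (Fin n →₀ ℕ)) =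
      ((Finset.univ : Finset (Fin n)).finsuppAntidiag p : Set (Fin n →₀ ℕ)) := by
    ext d
    simp [Finset.mem_finsuppAntidiag, Finsupp.degree_eq_sum]
  rw [h1, Module.finrank_eq_nat_card_basis (MvPolynomial.basisRestrictSupport k _), h2]
  rw [Nat.card_coe_set_eq, Set.ncard_coe_finset, Finset.card_finsuppAntidiag_nat_eq_choose,
    Finset.card_univ, Fintype.card_fin]
  obtain ⟨m, rfl⟩ := Nat.exists_eq_add_of_le' hn
  rw [show m + 1 + p - 1 = m + p by omega, Nat.add_sub_cancel, Nat.choose_symm_add.symm,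
    Nat.cast_add_choose]

instance finite_homogeneousSubmodule (p : ℕ) :
    Module.Finite k (MvPolynomial.homogeneousSubmodule (Fin n) k p) :=
  Module.Finite.iff_fg.2 (MvPolynomial.homogeneousSubmodule_fg (Fin n) k p)

/-- `S^p(V(n)) ⊗ V(n)` as the space of families of homogeneous polynomials of degree `p`. -/
def koszulDegreeEquiv (k : Type u) [Field k] (n p : ℕ) :
    koszulDegree k n p ≃ₗ[k] (Fin n → MvPolynomial.homogeneousSubmodule (Fin n) k p) where
  toFun w i := ⟨w.1 i, mem_koszulDegree.1 w.2 i⟩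
  invFun v := ⟨fun i => (v i).1, mem_koszulDegree.2 fun i => (v i).2⟩
  map_add' _ _ := rfl
  map_smul' _ _ := rfl
  left_inv _ := rfl
  right_inv _ := rfl

instance finite_koszulDegree (p : ℕ) : Module.Finite k (koszulDegree k n p) :=
  Module.Finite.equiv (koszulDegreeEquiv k n p).symm

instance finite_koszulCycles (p : ℕ) : Module.Finite k (koszulCycles k n p) :=
  Module.Finite.of_injective (Submodule.inclusion (inf_le_left : _ ≤ koszulDegree k n p))
    (Submodule.inclusion_injective _)

theorem finrank_koszulDegree (p : ℕ) : Module.finrank k (koszulDegree k n p) =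
    n * Module.finrank k (MvPolynomial.homogeneousSubmodule (Fin n) k p) := by
  rw [(koszulDegreeEquiv k n p).finrank_eq, Module.finrank_pi_fintype]
  simp

theorem finrank_map_add_finrank_inf_ker {V W : Type*} [AddCommGroup V] [Module k V]
    [AddCommGroup W] [Module k W] (f : V →ₗ[k] W) (P : Submodule k V) [Module.Finite k P] :
    Module.finrank k (P.map f) + Module.finrank k (P ⊓ LinearMap.ker f : Submodule k V) =
      Module.finrank k P := by
  rw [← (f.domRestrict P).finrank_range_add_finrank_ker, LinearMap.range_domRestrict,
    LinearMap.ker_domRestrict]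
  congr 1
  rw [← Submodule.finrank_map_subtype_eq P, Submodule.map_comap_subtype]

theorem map_koszulD1_koszulDegree (p : ℕ) : (koszulDegree k n p).map (koszulD1 k n) =
    MvPolynomial.homogeneousSubmodule (Fin n) k (p + 1) := by
  refine le_antisymm ?_ fun m hm => ?_
  · rintro _ ⟨w, hw, rfl⟩
    have h := famComponent_of_mem (d := p) hw
    rw [if_pos rfl] at h
    rw [← h, koszulD1_eq, ← homogeneousComponent_kd1]
    exact MvPolynomial.homogeneousComponent_isHomogeneous _ _
  · obtain ⟨w, hw⟩ := exists_kd1_symX m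
    refine ⟨famComponent k n p w, famComponent_mem p w, ?_⟩
    have h0 : MvPolynomial.constantCoeff m = 0 :=
      MvPolynomial.IsHomogeneous.coeff_eq_zero hm (by simp)
    rw [h0, map_zero, zero_add] at hw
    rw [koszulD1_eq, ← homogeneousComponent_kd1, ← hw,
      MvPolynomial.homogeneousComponent_of_mem hm, if_pos rfl]

theorem koszulDegree_inf_ker_koszulD2_zero (hn : 2 ≤ n) :
    koszulDegree k n 0 ⊓ LinearMap.ker (koszulD2 k n) = ⊥ := by
  refine eq_bot_iff.2 ?_
  rintro v ⟨hv, hv0⟩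
  rw [SetLike.mem_coe, LinearMap.mem_ker, koszulD2_eq] at hv0
  obtain ⟨u, rfl⟩ := symX_exact_two hn v hv0
  refine (Submodule.mem_bot k).2 ?_
  have h := famComponent_of_mem (d := 0) hv
  rw [if_pos rfl] at h
  rw [← h]
  funext i
  rw [famComponent_apply, kd3_apply, symX_apply, homogeneousComponent_zero_X_mul, Pi.zero_apply]

theorem koszulDegree_inf_ker_koszulD2_succ (hn : 2 ≤ n) (p : ℕ) :
    koszulDegree k n (p + 1) ⊓ LinearMap.ker (koszulD2 k n) =
      (MvPolynomial.homogeneousSubmodule (Fin n) k p).map (kd3 (symX k n)) := by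
  refine le_antisymm ?_ ?_
  · rintro v ⟨hv, hv0⟩
    rw [SetLike.mem_coe, LinearMap.mem_ker, koszulD2_eq] at hv0
    obtain ⟨u, rfl⟩ := symX_exact_two hn v hv0
    refine ⟨MvPolynomial.homogeneousComponent p u,
      MvPolynomial.homogeneousComponent_isHomogeneous _ _, ?_⟩
    have h := famComponent_of_mem (d := p + 1) hv
    rw [if_pos rfl] at h
    rw [← h]
    funext i
    rw [famComponent_apply, kd3_apply, kd3_apply, symX_apply, symX_apply,
      homogeneousComponent_succ_X_mul]
  · rintro _ ⟨u, hu, rfl⟩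
    refine ⟨mem_koszulDegree.2 fun i => ?_, ?_⟩
    · have := (MvPolynomial.isHomogeneous_X k i).mul hu
      rwa [add_comm 1 p] at this
    · rw [SetLike.mem_coe, LinearMap.mem_ker, koszulD2_eq, kd2_kd3 cubic_symX]

theorem finrank_koszulCycles (p : ℕ) : Module.finrank k (koszulCycles k n p) +
    Module.finrank k (MvPolynomial.homogeneousSubmodule (Fin n) k (p + 1)) =
      n * Module.finrank k (MvPolynomial.homogeneousSubmodule (Fin n) k p) := by
  rw [← finrank_koszulDegree, ← finrank_map_add_finrank_inf_ker (koszulD1 k n) (koszulDegree k n p),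
    map_koszulD1_koszulDegree, add_comm]
  rfl

theorem finrank_koszulBoundaries_two (hn : 2 ≤ n) :
    Module.finrank k (koszulBoundaries k n 2) =
      n * Module.finrank k (MvPolynomial.homogeneousSubmodule (Fin n) k 0) := by
  rw [← finrank_koszulDegree, ← finrank_map_add_finrank_inf_ker (koszulD2 k n) (koszulDegree k n 0),
    koszulDegree_inf_ker_koszulD2_zero hn, finrank_bot, add_zero]
  rfl

theorem finrank_koszulBoundaries_add_three (hn : 2 ≤ n) (p : ℕ) :
    Module.finrank k (koszulBoundaries k n (p + 3)) +
      Module.finrank k (MvPolynomial.homogeneousSubmodule (Fin n) k p) =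
      n * Module.finrank k (MvPolynomial.homogeneousSubmodule (Fin n) k (p + 1)) := by
  have hinj : Function.Injective (kd3 (symX k n)) :=
    (injective_iff_map_eq_zero _).2 fun u hu => symX_exact_three hn u hu
  rw [← finrank_koszulDegree,
    ← finrank_map_add_finrank_inf_ker (koszulD2 k n) (koszulDegree k n (p + 1)),
    koszulDegree_inf_ker_koszulD2_succ hn,
    ← (Submodule.equivMapOfInjective _ hinj _).finrank_eq]
  rfl

theorem finrank_H1_add (p : ℕ) : Module.finrank k (H1 k n p) +
    Module.finrank k (koszulBoundaries k n p) = Module.finrank k (koszulCycles k n p) := by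
  rw [← (koszulEquiv k n p).finrank_eq,
    ← (Submodule.submoduleOfEquivOfLe (koszulBoundaries_le p)).finrank_eq]
  exact Submodule.finrank_quotient_add_finrank _

end Dimension

end YangMills

end

theorem mainTheorem7 (k : Type u) [Field k] [IsAlgClosed k] [CharZero k] (n : ℕ) (hn : 2 ≤ n) :
    Nonempty (YangMills.H k n 0 ≃ₗ[k] k) ∧
    (∀ i : ℕ, 2 ≤ i → Subsingleton (YangMills.H k n i)) ∧
    DirectSum.IsInternal (fun p : ℕ => YangMills.H1 k n p) ∧
    (∀ p : ℕ, ∃ e : YangMills.KoszulH1 k n p ≃ₗ[k] YangMills.H1 k n p,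
      ∀ w : YangMills.koszulCycles k n p,
        ∃ hw : YangMills.koszulChain k n w ∈ YangMills.cycles k (YangMills.Ym k n)
            (YangMills.Sym k n) 1,
          (e (Submodule.Quotient.mk w) : YangMills.H k n 1) = Submodule.Quotient.mk ⟨_, hw⟩) ∧
    (∀ p : ℕ, Module.Finite k (YangMills.H1 k n p)) ∧
    (∀ p : ℕ, p = 0 ∨ p = 1 →
      (Module.finrank k (YangMills.H1 k n p) : ℚ) =
        n * (((n + p - 1)! : ℚ) / (n - 1)!) - ((n + p)! : ℚ) / ((n - 1)! * (p + 1)!)) ∧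
    (Module.finrank k (YangMills.H1 k n 2) : ℚ) =
        n * (((n + 1)! : ℚ) / ((n - 1)! * 2 !)) - ((n + 2)! : ℚ) / ((n - 1)! * 3 !) - n ∧
    (∀ p : ℕ, 3 ≤ p →
      (Module.finrank k (YangMills.H1 k n p) : ℚ) =
        n * (((n + p - 1)! : ℚ) / ((n - 1)! * p !)) - ((n + p)! : ℚ) / ((n - 1)! * (p + 1)!)
          - n * (((n + p - 3)! : ℚ) / ((n - 1)! * (p - 2)!))
          + ((n + p - 4)! : ℚ) / ((n - 1)! * (p - 3)!)) := by
  have hh := fun p => YangMills.finrank_homogeneousSubmodule (k := k) (n := n) (by omega) p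
  have hC : ∀ p, (Module.finrank k (YangMills.koszulCycles k n p) : ℚ) +
      Module.finrank k (MvPolynomial.homogeneousSubmodule (Fin n) k (p + 1)) =
        n * Module.finrank k (MvPolynomial.homogeneousSubmodule (Fin n) k p) := fun p => by
    exact_mod_cast YangMills.finrank_koszulCycles (k := k) (n := n) p
  have hA : ∀ p, (Module.finrank k (YangMills.H1 k n p) : ℚ) +
      Module.finrank k (YangMills.koszulBoundaries k n p) =
        Module.finrank k (YangMills.koszulCycles k n p) := fun p => by
    exact_mod_cast YangMills.finrank_H1_add (k := k) (n := n) p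
  refine ⟨YangMills.nonempty_H_zero_equiv k n, YangMills.subsingleton_H hn,
    YangMills.isInternal_H1, fun p => ⟨YangMills.koszulEquiv k n p, fun w => ?_⟩,
    fun p => Module.Finite.equiv (YangMills.koszulEquiv k n p), fun p hp => ?_, ?_, fun p hp => ?_⟩
  · have h := YangMills.koszulChainₗ_mem_cycles w.2.2
    rw [YangMills.koszulChainₗ_apply] at h
    exact ⟨h, by
      rw [YangMills.koszulEquiv_mk]
      exact congrArg Submodule.Quotient.mk (Subtype.ext (YangMills.koszulChainₗ_apply w.1))⟩
  · have hB : Module.finrank k (YangMills.koszulBoundaries k n p) = 0 := by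
      obtain rfl | rfl := hp <;> exact finrank_bot k _
    have h1 := hA p
    rw [hB, Nat.cast_zero, add_zero, eq_sub_of_add_eq (hC p), hh, hh] at h1
    rw [h1, show n + (p + 1) - 1 = n + p by omega]
    obtain rfl | rfl := hp <;> simp
  · have hB := YangMills.finrank_koszulBoundaries_two (k := k) hn
    have h1 := hA 2
    rw [hB, eq_sub_of_add_eq (hC 2), Nat.cast_mul, hh, hh, hh] at h1
    rw [eq_sub_of_add_eq h1, show n + 2 - 1 = n + 1 by omega, show n + (2 + 1) - 1 = n + 2 by omega,
      show n + 0 - 1 = n - 1 by omega, Nat.factorial_zero, Nat.cast_one, mul_one,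
      div_self (a := ((n - 1)! : ℚ)) (Nat.cast_ne_zero.2 (Nat.factorial_ne_zero _)), mul_one]
  · obtain ⟨q, rfl⟩ := Nat.exists_eq_add_of_le' hp
    have hB : (Module.finrank k (YangMills.koszulBoundaries k n (q + 3)) : ℚ) +
        Module.finrank k (MvPolynomial.homogeneousSubmodule (Fin n) k q) =
          n * Module.finrank k (MvPolynomial.homogeneousSubmodule (Fin n) k (q + 1)) := by
      exact_mod_cast YangMills.finrank_koszulBoundaries_add_three (k := k) hn q
    have h1 := hA (q + 3)
    rw [eq_sub_of_add_eq hB, eq_sub_of_add_eq (hC (q + 3)), hh, hh, hh, hh] at h1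
    rw [eq_sub_of_add_eq h1, show n + (q + 3 + 1) - 1 = n + (q + 3) by omega,
      show n + (q + 3) - 3 = n + (q + 1) - 1 by omega, show n + (q + 3) - 4 = n + q - 1 by omega,
      show q + 3 - 2 = q + 1 by omega, show q + 3 - 3 = q by omega]
    ring
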